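/- Let $q$ be a prime power, $n\ge 3$, and let $\operatorname{AG}(n,q)$ be the affine space whose flats are the cosets of subspaces of an $n$-dimensional vector space over $\mathbb F_q$. Let $X=X_q(n,1)$ be the graph whose vertices are the lines of $\operatorname{AG}(n,q)$, two distinct lines being adjacent if and only if they intersect. For $\theta\in\mathbb R$, a $\theta$-eigenfunction of $X$ is a function $f:V(X)\to\mathbb R$, $f\not\equiv 0$, with $\theta f(u)=\sum_{w\sim u}f(w)$ for every vertex $u$; it is optimal if its support has minimum cardinality among all $\theta$-eigenfunctions. For a primitive strongly regular graph (i.e. the graph and its complement are connected) with parameters $(v,k,\lambda,\mu)$ and a non-principal eigenvalue $\theta\neq k$, the weight-distribution bound states that every $\theta$-eigenfunction has at least $1+|\theta|+\left|\frac{(\theta-\lambda)\theta-k}{\mu}\right|$ non-zeroes. Two lines of $\operatorname{AG}(n,q)$ are skew if they are disjoint and not parallel. A transversal of a set $R$ of lines in a $3$-dimensional affine subspace $A$ is a line of $A$ that meets each line of $R$ in exactly one point. An affine regulus in $A$ is a non-empty set $R$ of pairwise skew lines of $A$ such that through each point of each line of $R$ there is a transversal of $R$, and through each point of each transversal of $R$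 there is a line of $R$. An ordered pair $(R,S)$ of affine reguli in the same $A$ is called opposite if every line of $S$ is a transversal of $R$. Theorem. (1) $X$ is a primitive strongly regular graph, $-q$ is a non-principal eigenvalue of $X$, the weight-distribution bound for $-q$ equals $2q$, and it is attained: every $-q$-eigenfunction has at least $2q$ non-zeroes, and some $-q$-eigenfunction has exactly $2q$. (2) Every optimal $-q$-eigenfunction is a non-zero constant multiple of one with values in $\{1,-1,0\}$, and is of exactly one of the following two types, both of which occur: in the first type, any two lines on which $f$ has the same sign are parallel; in the second type, any two distinct lines on which $f$ has the same sign are skew. (3) The map $(C,D)\mapsto \mathbf 1_C-\mathbf 1_D$ is a bijection from the ordered pairs of distinct parallel classes of lines of a common affine subplane $\operatorname{AG}(2,q)$ of $\operatorname{AG}(n,q)$ onto the $\{1,-1,0\}$-valued optimal $-q$-eigenfunctions of the first type. (4) The map $(R,S)\mapsto \mathbf 1_R-\mathbf 1_S$ is a bijection from the opposite pairs of affine reguli in $3$-dimensional affine subspaces of $\operatorname{AG}(n,q)$ onto the $\{1,-1,0\}$-valued optimal $-q$-eigenfunctions of the second type. If $q\ge 3$, then for every affine regulus $R$ in a $3$-dimensional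 affine subspace the set $R^{opp}$ of all its transversals is again an affine regulus in that subspace, and $R\mapsto \mathbf 1_R-\mathbf 1_{R^{opp}}$ is a bijection from the affine reguli in $3$-dimensional affine subspaces onto the same set of eigenfunctions. (Interchanging the two members of a pair replaces the eigenfunction by its negative; so, up to arbitrary non-zero constant factors, optimal eigenfunctions correspond to unordered pairs.) -/

import Mathlib

noncomputable section

/-! ### Eigenfunctions of graphs and the weight-distribution bound -/

section Graphs

variable {W : Type*} [Fintype W]

open Classical in
/-- `f` is a `θ`-eigenfunction of the graph `G`: it is not identically zero and `θ * f u` is the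
sum of `f` over the neighbours of `u`, for every vertex `u`. -/
def IsEigenfunction (G : SimpleGraph W) (θ : ℝ) (f : W → ℝ) : Prop :=
  f ≠ 0 ∧ ∀ u : W, θ * f u = ∑ w ∈ G.neighborFinset u, f w

/-- The number of non-zeroes of a function. -/
def supportCard (f : W → ℝ) : ℕ := (Function.support f).ncard

/-- A `θ`-eigenfunction is optimal if its support has the minimum cardinality among all
`θ`-eigenfunctions. -/
def IsOptimalEigenfunction (G : SimpleGraph W) (θ : ℝ) (f : W → ℝ) : Prop :=
  IsEigenfunction G θ f ∧ ∀ g : W → ℝ, IsEigenfunction G θ g → supportCard f ≤ supportCard g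

/-- The weight-distribution bound for a primitive strongly regular graph with parameters
`(v, k, l, μ)` and its non-principal eigenvalue `θ`. -/
def weightDistributionBound (k l μ : ℕ) (θ : ℝ) : ℝ :=
  1 + |θ| + |((θ - l) * θ - k) / μ|

/-- All values of `f` lie in `{1, -1, 0}`. -/
def IsSignValued (f : W → ℝ) : Prop := ∀ w, f w = 1 ∨ f w = -1 ∨ f w = 0

/-- For disjoint sets `T₀`, `T₁`, the function with value `1` on `T₀`, value `-1` on `T₁`, and
value `0` elsewhere. -/
def signedIndicator (T : Set W × Set W) : W → ℝ :=
  T.1.indicator 1 - T.2.indicator 1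

end Graphs

/-! ### The affine space over a field `F` with underlying vector space `V` -/

section Geometry

variable (F V : Type*) [Field F] [AddCommGroup V] [Module F V]

/-- Cosets of the `d`-dimensional vector subspaces. -/
def IsFlat {F V : Type*} [Field F] [AddCommGroup V] [Module F V] (d : ℕ)
    (A : AffineSubspace F V) : Prop :=
  (A : Set V).Nonempty ∧ Module.finrank F A.direction = d

/-- The lines of the affine space, i.e. the blocks of the affine design. -/
abbrev AffLine : Type _ := {l : AffineSubspace F V // IsFlat 1 l}

instance [Finite V] : Finite (AffLine F V) :=
  Finite.of_injective (fun l : AffLine F V => ((l : AffineSubspace F V) : Set V))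
    (fun _ _ h => Subtype.ext (SetLike.coe_injective h))

instance [Finite V] : Fintype (AffLine F V) := Fintype.ofFinite _

instance : DecidableEq (AffLine F V) := Classical.decEq _

/-- The block graph of the affine design: the vertices are the lines of the affine space, and two
distinct lines are adjacent if and only if they have a point in common. -/
def blockGraph : SimpleGraph (AffLine F V) where
  Adj l m := l ≠ m ∧ ∃ p : V, p ∈ l.1 ∧ p ∈ m.1
  symm := ⟨fun _ _ h => ⟨h.1.symm, h.2.imp fun _ hp => hp.symm⟩⟩
  loopless := ⟨fun _ h => h.1 rfl⟩

instance : DecidableRel (blockGraph F V).Adj := Classical.decRel _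

variable {F V}

/-- Two lines are skew if they have no point in common and are not parallel. -/
def Skew (l m : AffLine F V) : Prop :=
  (¬ ∃ p : V, p ∈ l.1 ∧ p ∈ m.1) ∧ ¬ l.1.Parallel m.1

/-- `C` is one of the parallel classes of lines of the plane `P`. -/
def IsParallelClass (P : AffineSubspace F V) (C : Set (AffLine F V)) : Prop :=
  ∃ l : AffLine F V, l.1 ≤ P ∧ C = {m : AffLine F V | m.1 ≤ P ∧ m.1.Parallel l.1}

/-- Ordered pairs of distinct parallel classes of lines of a common affine subplane. -/
def IsParallelClassPair (C D : Set (AffLine F V)) : Prop :=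
  ∃ P : AffineSubspace F V, IsFlat 2 P ∧ IsParallelClass P C ∧ IsParallelClass P D ∧ C ≠ D

/-- The transversals, in the subspace `A`, of a set `R` of lines: the lines of `A` that meet each
line of `R` in exactly one point. -/
def transversals (A : AffineSubspace F V) (R : Set (AffLine F V)) : Set (AffLine F V) :=
  {t | t.1 ≤ A ∧ ∀ l ∈ R, ∃! p : V, p ∈ t.1 ∧ p ∈ l.1}

/-- `R` is an affine regulus in the subspace `A`, where `A` is `3`-dimensional. -/
structure IsAffineRegulus (A : AffineSubspace F V) (R : Set (AffLine F V)) : Prop where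
  flat : IsFlat 3 A
  nonempty : R.Nonempty
  subset : ∀ l ∈ R, l.1 ≤ A
  skew : R.Pairwise Skew
  /-- Through each point of each line of `R` there is a transversal of `R`. -/
  exists_transversal : ∀ l ∈ R, ∀ p ∈ l.1, ∃ t ∈ transversals A R, p ∈ t.1
  /-- Through each point of a transversal of `R` there is a line of `R`. -/
  exists_line : ∀ t ∈ transversals A R, ∀ p ∈ t.1, ∃ l ∈ R, p ∈ l.1

/-- `R` and `S` are affine reguli in the same `3`-dimensional subspace, opposite to each other:
the lines of `S` are transversals of `R`. (If `F` has more than two elements, then `S` is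
necessarily the set of all transversals of `R`.) -/
def AreOppositeReguli (R S : Set (AffLine F V)) : Prop :=
  ∃ A : AffineSubspace F V, IsAffineRegulus A R ∧ IsAffineRegulus A S ∧ S ⊆ transversals A R

/-- First type: any two lines on which `f` has the same sign are parallel. -/
def IsFirstType (f : AffLine F V → ℝ) : Prop :=
  ∀ l m : AffLine F V, 0 < f l * f m → l.1.Parallel m.1

/-- Second type: any two distinct lines on which `f` has the same sign are skew. -/
def IsSecondType (f : AffLine F V → ℝ) : Prop :=
  ∀ l m : AffLine F V, l ≠ m → 0 < f l * f m → Skew l m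

end Geometry

end

/-! Let `N` be the point-line incidence matrix. A line has `q` points and two distinct lines share
at most one, so `Nᵀ N = q I + A`, where `A` is the adjacency matrix of the graph. If `A f = -q f`,
then `|N f|² = ⟨f, Nᵀ N f⟩ = 0`; hence the `-q`-eigenfunctions are the non-zero `f` whose values on
the lines through each point sum to zero (`isEigenfunction_iff`).

If `f l > 0`, each of the `q` points of `l` lies on a line where `f` is negative, and these lines
are distinct because each meets `l` only once. So there are at least `q` negative lines and, by
symmetry, at least `q` positive ones. In case of equality every positive line meets every negative
one and lines of the same sign are disjoint: the support is a `q × q` grid (`IsGrid`). Exactly two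
support lines pass through each grid point, which forces the values `c` and `-c`
(`isGrid_of_supportCard_eq`). Conversely, the signed indicator of any grid has zero point sums.

It remains to classify grids. Two parallel lines on one side force the whole grid into their plane,
where disjoint lines are parallel, and both sides are then full parallel classes. Otherwise both
sides consist of skew lines, and the grid is a pair of opposite reguli in the `3`-space spanned by
two of them. The covering conditions all come from one count, `ncard_eq_iff_cover`. The rulings of
`z = x * y` show that skew grids exist. The strongly regular parameters follow by double counting.
-/

/-! ### Lines: joining, meeting and counting points -/

section Lines

variable {F V : Type*} [Field F] [AddCommGroup V] [Module F V]

namespace AffLine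

/-- The line through `p` with a prescribed one-dimensional direction. -/
def through (p : V) (W : Submodule F V) (hW : Module.finrank F W = 1) : AffLine F V :=
  ⟨AffineSubspace.mk' p W, ⟨p, AffineSubspace.self_mem_mk' p W⟩, by
    rwa [AffineSubspace.direction_mk']⟩

theorem mem_through (p : V) (W : Submodule F V) (hW : Module.finrank F W = 1) :
    p ∈ (through p W hW).1 :=
  AffineSubspace.self_mem_mk' p W

theorem direction_through (p : V) (W : Submodule F V) (hW : Module.finrank F W = 1) :
    (through p W hW).1.direction = W :=
  AffineSubspace.direction_mk' p W

theorem parallel_iff {l m : AffLine F V} :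
    l.1.Parallel m.1 ↔ l.1.direction = m.1.direction := by
  rw [AffineSubspace.parallel_iff_direction_eq_and_eq_bot_iff_eq_bot]
  have hl : l.1 ≠ ⊥ := (AffineSubspace.nonempty_iff_ne_bot _).1 l.2.1
  have hm : m.1 ≠ ⊥ := (AffineSubspace.nonempty_iff_ne_bot _).1 m.2.1
  simp [hl, hm]

theorem eq_of_parallel {l m : AffLine F V} (h : l.1.Parallel m.1) {p : V} (hl : p ∈ l.1)
    (hm : p ∈ m.1) : l = m :=
  Subtype.ext (AffineSubspace.ext_of_direction_eq (parallel_iff.1 h) ⟨p, hl, hm⟩)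

theorem direction_eq_span {l : AffLine F V} {x y : V} (hx : x ∈ l.1) (hy : y ∈ l.1)
    (hxy : x ≠ y) : l.1.direction = Submodule.span F {y - x} := by
  have hfin : FiniteDimensional F l.1.direction :=
    FiniteDimensional.of_finrank_pos (by rw [l.2.2]; exact one_pos)
  symm
  apply Submodule.eq_of_le_of_finrank_eq
  · rw [Submodule.span_singleton_le_iff_mem]
    exact AffineSubspace.vsub_mem_direction hy hx
  · rw [finrank_span_singleton (sub_ne_zero.2 hxy.symm), l.2.2]

theorem eq_of_mem {l m : AffLine F V} {x y : V} (hxy : x ≠ y) (hxl : x ∈ l.1) (hyl : y ∈ l.1)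
    (hxm : x ∈ m.1) (hym : y ∈ m.1) : l = m :=
  eq_of_parallel (parallel_iff.2
    ((direction_eq_span hxl hyl hxy).trans (direction_eq_span hxm hym hxy).symm)) hxl hxm

theorem le_of_mem {l : AffLine F V} {A : AffineSubspace F V} {x y : V} (hxy : x ≠ y)
    (hxl : x ∈ l.1) (hyl : y ∈ l.1) (hxA : x ∈ A) (hyA : y ∈ A) : l.1 ≤ A := by
  have hd : l.1.direction ≤ A.direction := by
    rw [direction_eq_span hxl hyl hxy, Submodule.span_singleton_le_iff_mem]
    exact AffineSubspace.vsub_mem_direction hyA hxA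
  intro z hz
  rw [← sub_add_cancel z x]
  exact AffineSubspace.vadd_mem_of_mem_direction
    (hd (AffineSubspace.vsub_mem_direction hz hxl)) hxA

theorem exists_mem_mem {x y : V} (hxy : x ≠ y) : ∃ l : AffLine F V, x ∈ l.1 ∧ y ∈ l.1 := by
  refine ⟨through x (Submodule.span F {y - x}) (finrank_span_singleton (sub_ne_zero.2 hxy.symm)),
    mem_through _ _ _, ?_⟩
  change y ∈ AffineSubspace.mk' x _
  rw [AffineSubspace.mem_mk']
  exact Submodule.mem_span_singleton_self _

theorem existsUnique_of_ne {l m : AffLine F V} (h : l ≠ m) {p : V} (hl : p ∈ l.1)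
    (hm : p ∈ m.1) : ∃! p : V, p ∈ l.1 ∧ p ∈ m.1 :=
  ⟨p, ⟨hl, hm⟩, fun _ hx => by_contra fun hxp => h (eq_of_mem hxp hx.1 hl hx.2 hm)⟩

theorem ncard_eq (l : AffLine F V) : (l.1 : Set V).ncard = Nat.card F := by
  obtain ⟨p, hp⟩ := l.2.1
  have : Nonempty l.1 := ⟨⟨p, hp⟩⟩
  have hfin : FiniteDimensional F l.1.direction :=
    FiniteDimensional.of_finrank_pos (by rw [l.2.2]; exact one_pos)
  have h1 : Nat.card l.1.direction = Nat.card F := by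
    rw [Module.natCard_eq_pow_finrank (K := F), l.2.2, pow_one]
  rw [← h1]
  exact (Nat.card_congr (Equiv.vaddConst (⟨p, hp⟩ : l.1))).symm

theorem exists_ne_mem [Finite V] [Finite F] (l : AffLine F V) (p : V) : ∃ x ∈ l.1, x ≠ p := by
  have h : 1 < (l.1 : Set V).ncard := by
    rw [ncard_eq]
    exact Finite.one_lt_card
  exact Set.exists_ne_of_one_lt_ncard h p

/-- Two lines meeting in a single point are not parallel. -/
theorem not_parallel_of_existsUnique [Finite V] [Finite F] {l m : AffLine F V}
    (h : ∃! p : V, p ∈ l.1 ∧ p ∈ m.1) : ¬ l.1.Parallel m.1 := by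
  intro hp
  obtain ⟨p, ⟨hl, hm⟩, hu⟩ := h
  obtain rfl := eq_of_parallel hp hl hm
  obtain ⟨x, hx, hne⟩ := l.exists_ne_mem p
  exact hne (hu x ⟨hx, hx⟩)

/-- Lines meet if the difference of two of their points lies in the sum of their directions. -/
theorem exists_mem_of_sub_mem {l m : AffLine F V} {x y : V} (hx : x ∈ l.1) (hy : y ∈ m.1)
    (h : y - x ∈ l.1.direction ⊔ m.1.direction) : ∃ p : V, p ∈ l.1 ∧ p ∈ m.1 := by
  obtain ⟨u, hu, v, hv, huv⟩ := Submodule.mem_sup.1 h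
  refine ⟨u + x, AffineSubspace.vadd_mem_of_mem_direction hu hx, ?_⟩
  have : u + x = (-v) + y := by
    rw [show y = u + v + x by rw [huv]; abel]
    abel
  rw [this]
  exact AffineSubspace.vadd_mem_of_mem_direction (neg_mem hv) hy

/-! ### Planes and 3-spaces spanned by two lines -/

section Directions

variable [Finite V]

theorem disjoint_direction {l m : AffLine F V} (h : ¬ l.1.Parallel m.1) :
    Disjoint l.1.direction m.1.direction := by
  rw [parallel_iff] at h
  rw [disjoint_iff]
  by_contra hne
  have hpos : 0 < Module.finrank F ↥(l.1.direction ⊓ m.1.direction) :=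
    
      Nat.pos_of_ne_zero fun e => hne (Submodule.finrank_eq_zero.1 e)
  have h1 : l.1.direction ⊓ m.1.direction = l.1.direction :=
    Submodule.eq_of_le_of_finrank_le inf_le_left (by rw [l.2.2]; omega)
  have h2 : l.1.direction ⊓ m.1.direction = m.1.direction :=
    Submodule.eq_of_le_of_finrank_le inf_le_right (by rw [m.2.2]; omega)
  exact h (h1.symm.trans h2)

theorem finrank_sup_direction {l m : AffLine F V} (h : ¬ l.1.Parallel m.1) :
    Module.finrank F ↥(l.1.direction ⊔ m.1.direction) = 2 := by
  have := Submodule.finrank_sup_add_finrank_inf_eq l.1.direction m.1.direction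
  rw [(disjoint_direction h).eq_bot, finrank_bot, l.2.2, m.2.2] at this
  omega

theorem exists_mem_of_le_plane {P : AffineSubspace F V} (hP : IsFlat 2 P) {l m : AffLine F V}
    (hl : l.1 ≤ P) (hm : m.1 ≤ P) (h : ¬ l.1.Parallel m.1) : ∃ p : V, p ∈ l.1 ∧ p ∈ m.1 := by
  obtain ⟨x, hx⟩ := l.2.1
  obtain ⟨y, hy⟩ := m.2.1
  apply exists_mem_of_sub_mem hx hy
  have : l.1.direction ⊔ m.1.direction = P.direction := by
    apply Submodule.eq_of_le_of_finrank_eq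
    · exact sup_le (AffineSubspace.direction_le hl) (AffineSubspace.direction_le hm)
    · rw [finrank_sup_direction h, hP.2]
  rw [this]
  exact AffineSubspace.vsub_mem_direction (hm hy) (hl hx)

theorem isFlat_sup_of_mem {l m : AffLine F V} (h : ¬ l.1.Parallel m.1) {p : V} (hl : p ∈ l.1)
    (hm : p ∈ m.1) : IsFlat 2 (l.1 ⊔ m.1) := by
  refine ⟨⟨p, (le_sup_left : l.1 ≤ l.1 ⊔ m.1) hl⟩, ?_⟩
  rw [AffineSubspace.direction_sup_eq_sup_direction hl hm]
  exact finrank_sup_direction h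

theorem isFlat_sup_of_parallel {l m : AffLine F V} (h : l.1.Parallel m.1) (hne : l ≠ m) :
    IsFlat 2 (l.1 ⊔ m.1) := by
  obtain ⟨x, hx⟩ := l.2.1
  obtain ⟨y, hy⟩ := m.2.1
  have hxy : x ≠ y := fun e => hne (eq_of_parallel h hx (e ▸ hy))
  obtain ⟨t, hxt, hyt⟩ := exists_mem_mem (F := F) hxy
  have ht : ¬ l.1.Parallel t.1 := fun hp => by
    obtain rfl := eq_of_parallel hp hx hxt
    exact hne (eq_of_parallel h hyt hy)
  refine ⟨⟨x, (le_sup_left : l.1 ≤ l.1 ⊔ m.1) hx⟩, ?_⟩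
  rw [AffineSubspace.direction_sup hx hy, ← parallel_iff.1 h, sup_idem, vsub_eq_sub,
    ← direction_eq_span hxt hyt hxy]
  exact finrank_sup_direction ht

/-- The two directions span dimension 2. A vector joining the lines adds one more, since if it lay
in the sum of the directions the lines would meet. -/
theorem isFlat_sup_of_skew {l m : AffLine F V} (h : Skew l m) : IsFlat 3 (l.1 ⊔ m.1) := by
  obtain ⟨x, hx⟩ := l.2.1
  obtain ⟨y, hy⟩ := m.2.1
  have hxy : y - x ∉ l.1.direction ⊔ m.1.direction := fun e =>
    h.1 (exists_mem_of_sub_mem hx hy e)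
  refine ⟨⟨x, (le_sup_left : l.1 ≤ l.1 ⊔ m.1) hx⟩, ?_⟩
  rw [AffineSubspace.direction_sup hx hy, vsub_eq_sub]
  have h0 : y - x ≠ 0 := fun e => hxy (e ▸ zero_mem _)
  have := Submodule.finrank_sup_add_finrank_inf_eq (l.1.direction ⊔ m.1.direction)
    (Submodule.span F {y - x})
  rw [((Submodule.disjoint_span_singleton' h0).2 hxy).eq_bot, finrank_bot,
    finrank_sup_direction h.2, finrank_span_singleton h0] at this
  omega

theorem eq_sup_of_skew {l m : AffLine F V} (h : Skew l m) {A : AffineSubspace F V}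
    (hA : IsFlat 3 A) (hl : l.1 ≤ A) (hm : m.1 ≤ A) : A = l.1 ⊔ m.1 := by
  have hle : l.1 ⊔ m.1 ≤ A := sup_le hl hm
  have hf := isFlat_sup_of_skew h
  refine (AffineSubspace.eq_of_direction_eq_of_nonempty_of_le ?_ hf.1 hle).symm
  exact Submodule.eq_of_le_of_finrank_eq (AffineSubspace.direction_le hle) (hf.2.trans hA.2.symm)

end Directions

end AffLine

end Lines

/-! ### Grids and their geometry -/

section Grids

variable {F V : Type*} [Field F] [AddCommGroup V] [Module F V]

/-- Two sets of `|F|` pairwise disjoint lines such that each line of the first set meets each line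
of the second set in exactly one point. -/
structure IsGrid (C D : Set (AffLine F V)) : Prop where
  ncard_left : C.ncard = Nat.card F
  ncard_right : D.ncard = Nat.card F
  disjoint_left : ∀ l ∈ C, ∀ m ∈ C, ∀ p, p ∈ l.1 → p ∈ m.1 → l = m
  disjoint_right : ∀ l ∈ D, ∀ m ∈ D, ∀ p, p ∈ l.1 → p ∈ m.1 → l = m
  meet : ∀ l ∈ C, ∀ m ∈ D, ∃! p, p ∈ l.1 ∧ p ∈ m.1

variable [Finite F] [Finite V]

omit [Finite F] in
/-- Pairwise disjoint lines that meet the line `l` cover `l` if and only if their number is the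
number of points of `l`. -/
theorem ncard_eq_iff_cover {l : AffLine F V} {D : Set (AffLine F V)}
    (hD : ∀ m ∈ D, ∀ m' ∈ D, ∀ p, p ∈ m.1 → p ∈ m'.1 → m = m')
    (hl : ∀ m ∈ D, ∃! p, p ∈ l.1 ∧ p ∈ m.1) :
    D.ncard = Nat.card F ↔ ∀ p ∈ l.1, ∃ m ∈ D, p ∈ m.1 := by
  have hex : ∀ m : AffLine F V, ∃ p : V, m ∈ D → p ∈ l.1 ∧ p ∈ m.1 := fun m => by
    by_cases hm : m ∈ D
    · obtain ⟨p, hp⟩ := (hl m hm).exists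
      exact ⟨p, fun _ => hp⟩
    · exact ⟨0, fun h => absurd h hm⟩
  choose g hg using hex
  have hinj : Set.InjOn g D := fun m hm m' hm' e =>
    hD m hm m' hm' (g m) (hg m hm).2 (e ▸ (hg m' hm').2)
  have hsub : g '' D ⊆ (l.1 : Set V) := by
    rintro _ ⟨m, hm, rfl⟩
    exact (hg m hm).1
  rw [← hinj.ncard_image, ← l.ncard_eq]
  constructor
  · intro h p hp
    have he := Set.eq_of_subset_of_ncard_le hsub h.ge
    have hp' : p ∈ g '' D := he ▸ hp
    obtain ⟨m, hm, rfl⟩ := hp'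
    exact ⟨m, hm, (hg m hm).2⟩
  · intro h
    congr 1
    refine Set.Subset.antisymm hsub fun p hp => ?_
    obtain ⟨m, hm, hpm⟩ := h p hp
    exact ⟨m, hm, (hl m hm).unique (hg m hm) ⟨hp, hpm⟩⟩

namespace IsGrid

variable {C D : Set (AffLine F V)}

omit [Finite F] [Finite V] in
theorem symm (h : IsGrid C D) : IsGrid D C :=
  ⟨h.2, h.1, h.4, h.3, fun l hl m hm => by simpa only [and_comm] using h.5 m hm l hl⟩

omit [Finite F] in
theorem cover (h : IsGrid C D) {l : AffLine F V} (hl : l ∈ C) {p : V} (hp : p ∈ l.1) :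
    ∃ m ∈ D, p ∈ m.1 :=
  (ncard_eq_iff_cover h.disjoint_right (h.meet l hl)).1 h.ncard_right p hp

theorem not_parallel (h : IsGrid C D) {l m : AffLine F V} (hl : l ∈ C) (hm : m ∈ D) :
    ¬ l.1.Parallel m.1 :=
  AffLine.not_parallel_of_existsUnique (h.meet l hl m hm)

theorem disjoint (h : IsGrid C D) : Disjoint C D :=
  Set.disjoint_left.2 fun _ hl hm => h.not_parallel hl hm (.refl _)

theorem exists_pair (h : IsGrid C D) : ∃ l ∈ C, ∃ m ∈ C, l ≠ m := by
  have : 1 < C.ncard := by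
    rw [h.ncard_left]
    exact Finite.one_lt_card
  obtain ⟨l, m, hl, hm, hne⟩ := (Set.one_lt_ncard_iff (Set.toFinite C)).1 this
  exact ⟨l, hl, m, hm, hne⟩

omit [Finite F] [Finite V] in
/-- A subspace with two lines of one side contains the other side. -/
theorem le_of_pair_le (h : IsGrid C D) {A : AffineSubspace F V} {l m : AffLine F V} (hl : l ∈ C)
    (hm : m ∈ C) (hne : l ≠ m) (hlA : l.1 ≤ A) (hmA : m.1 ≤ A) {t : AffLine F V} (ht : t ∈ D) :
    t.1 ≤ A := by
  obtain ⟨x, hxl, hxt⟩ := (h.meet l hl t ht).exists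
  obtain ⟨y, hym, hyt⟩ := (h.meet m hm t ht).exists
  refine AffLine.le_of_mem (fun e => ?_) hxt hyt (hlA hxl) (hmA hym)
  exact hne (h.disjoint_left l hl m hm x hxl (e ▸ hym))

/-- Two lines of `C` in `A` pull all of `D` into `A`, and two lines of `D` then pull `C` back in. -/
theorem le_of_pair_le' (h : IsGrid C D) {A : AffineSubspace F V} {l m : AffLine F V} (hl : l ∈ C)
    (hm : m ∈ C) (hne : l ≠ m) (hlA : l.1 ≤ A) (hmA : m.1 ≤ A) {t : AffLine F V} (ht : t ∈ C) :
    t.1 ≤ A := by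
  obtain ⟨x, hx, y, hy, hxy⟩ := h.symm.exists_pair
  exact h.symm.le_of_pair_le hx hy hxy (h.le_of_pair_le hl hm hne hlA hmA hx)
    (h.le_of_pair_le hl hm hne hlA hmA hy) ht

omit [Finite F] in
/-- The lines of a grid in a plane are those of a parallel class. -/
theorem parallel_of_le (h : IsGrid C D) {P : AffineSubspace F V} (hP : IsFlat 2 P)
    (hCP : ∀ l ∈ C, l.1 ≤ P) {l m : AffLine F V} (hl : l ∈ C) (hm : m ∈ C) :
    l.1.Parallel m.1 := by
  by_contra hn
  obtain ⟨p, hpl, hpm⟩ := AffLine.exists_mem_of_le_plane hP (hCP l hl) (hCP m hm) hn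
  exact hn (h.disjoint_left l hl m hm p hpl hpm ▸ .refl _)

/-- A grid with two parallel lines lies in a plane. -/
theorem exists_plane (h : IsGrid C D) {l m : AffLine F V} (hl : l ∈ C) (hm : m ∈ C)
    (hne : l ≠ m) (hp : l.1.Parallel m.1) :
    ∃ P : AffineSubspace F V, IsFlat 2 P ∧ (∀ t ∈ C, t.1 ≤ P) ∧ ∀ t ∈ D, t.1 ≤ P :=
  ⟨l.1 ⊔ m.1, AffLine.isFlat_sup_of_parallel hp hne,
    fun _ => h.le_of_pair_le' hl hm hne le_sup_left le_sup_right,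
    fun _ => h.le_of_pair_le hl hm hne le_sup_left le_sup_right⟩

/-- Disjoint lines are either parallel or skew, and a single pair of parallel lines makes the whole
grid planar, which decides both sides at once. Hence mixed cases do not arise. -/
theorem pairwise_skew_or_parallel (h : IsGrid C D) :
    (C.Pairwise Skew ∧ D.Pairwise Skew) ∨
      ((∀ l ∈ C, ∀ m ∈ C, l.1.Parallel m.1) ∧ ∀ l ∈ D, ∀ m ∈ D, l.1.Parallel m.1) := by
  have key : ∀ {C D : Set (AffLine F V)}, IsGrid C D → C.Pairwise Skew ∨
      ((∀ l ∈ C, ∀ m ∈ C, l.1.Parallel m.1) ∧ ∀ l ∈ D, ∀ m ∈ D, l.1.Parallel m.1) := by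
    intro C D h
    by_cases hp : ∃ l ∈ C, ∃ m ∈ C, l ≠ m ∧ l.1.Parallel m.1
    · obtain ⟨l, hl, m, hm, hne, hp⟩ := hp
      obtain ⟨P, hP, hC, hD⟩ := h.exists_plane hl hm hne hp
      exact Or.inr ⟨fun _ h1 _ h2 => h.parallel_of_le hP hC h1 h2,
        fun _ h1 _ h2 => h.symm.parallel_of_le hP hD h1 h2⟩
    · push Not at hp
      exact Or.inl fun l hl m hm hne =>
        ⟨fun ⟨p, h1, h2⟩ => hne (h.disjoint_left l hl m hm p h1 h2), hp l hl m hm hne⟩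
  rcases key h with h1 | h1
  · rcases key h.symm with h2 | h2
    · exact Or.inl ⟨h1, h2⟩
    · exact Or.inr h2.symm
  · exact Or.inr h1

theorem isParallelClassPair (h : IsGrid C D) (hC : ∀ l ∈ C, ∀ m ∈ C, l.1.Parallel m.1) :
    IsParallelClassPair C D := by
  obtain ⟨l, hl, m, hm, hne⟩ := h.exists_pair
  obtain ⟨P, hP, hCP, hDP⟩ := h.exists_plane hl hm hne (hC l hl m hm)
  have key : ∀ {C D : Set (AffLine F V)}, IsGrid C D → (∀ l ∈ C, l.1 ≤ P) → (∀ l ∈ D, l.1 ≤ P) →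
      IsParallelClass P C := by
    intro C D h hCP hDP
    obtain ⟨l, hl, -⟩ := h.exists_pair
    obtain ⟨t, ht, -⟩ := h.symm.exists_pair
    refine ⟨l, hCP l hl, Set.ext fun s => ⟨fun hs => ⟨hCP s hs, h.parallel_of_le hP hCP hs hl⟩, ?_⟩⟩
    -- The side is the full class: a parallel `s` in the plane crosses `t` at a point that some line
    -- of `C` already covers, and parallel lines through one point coincide.
    rintro ⟨hsP, hsl⟩
    obtain ⟨p, hps, hpt⟩ := AffLine.exists_mem_of_le_plane hP hsP (hDP t ht)
      fun e => h.not_parallel hl ht (hsl.symm.trans e)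
    obtain ⟨s', hs', hps'⟩ := h.symm.cover ht hpt
    rwa [AffLine.eq_of_parallel (hsl.trans (h.parallel_of_le hP hCP hl hs')) hps hps']
  refine ⟨P, hP, key h hCP hDP, key h.symm hDP hCP, fun e => ?_⟩
  exact Set.disjoint_left.1 h.disjoint hl (e ▸ hl)

/-- One side of a grid of skew lines in a `3`-space is an affine regulus. -/
theorem isAffineRegulus (h : IsGrid C D) (hs : C.Pairwise Skew) {A : AffineSubspace F V}
    (hA : IsFlat 3 A) (hC : ∀ l ∈ C, l.1 ≤ A) (hD : ∀ l ∈ D, l.1 ≤ A) :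
    IsAffineRegulus A C ∧ D ⊆ transversals A C := by
  have hDt : D ⊆ transversals A C := fun t ht => ⟨hD t ht, h.symm.meet t ht⟩
  obtain ⟨l, hl, -⟩ := h.exists_pair
  refine ⟨⟨hA, ⟨l, hl⟩, hC, hs, fun l hl p hp => ?_, fun t ht p hp => ?_⟩, hDt⟩
  · obtain ⟨t, ht, hpt⟩ := h.cover hl hp
    exact ⟨t, hDt ht, hpt⟩
  · exact (ncard_eq_iff_cover h.disjoint_left ht.2).1 h.ncard_left p hp

theorem areOppositeReguli (h : IsGrid C D) (hC : C.Pairwise Skew) (hD : D.Pairwise Skew) :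
    AreOppositeReguli C D := by
  obtain ⟨l, hl, m, hm, hne⟩ := h.exists_pair
  have hf := AffLine.isFlat_sup_of_skew (hC hl hm hne)
  have h1 : ∀ t ∈ C, t.1 ≤ l.1 ⊔ m.1 :=
    fun _ => h.le_of_pair_le' hl hm hne le_sup_left le_sup_right
  have h2 : ∀ t ∈ D, t.1 ≤ l.1 ⊔ m.1 :=
    fun _ => h.le_of_pair_le hl hm hne le_sup_left le_sup_right
  exact ⟨l.1 ⊔ m.1, (h.isAffineRegulus hC hf h1 h2).1, (h.symm.isAffineRegulus hD hf h2 h1).1,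
    (h.isAffineRegulus hC hf h1 h2).2⟩

end IsGrid

/-! ### Pairs of parallel classes -/

omit [Finite F] [Finite V] in
theorem IsParallelClass.parallel {P : AffineSubspace F V} {C : Set (AffLine F V)}
    (h : IsParallelClass P C) {l m : AffLine F V} (hl : l ∈ C) (hm : m ∈ C) :
    l.1.Parallel m.1 := by
  obtain ⟨t, -, rfl⟩ := h
  exact hl.2.trans hm.2.symm

omit [Finite F] in
theorem IsParallelClassPair.isGrid {C D : Set (AffLine F V)} (h : IsParallelClassPair C D) :
    IsGrid C D := by
  obtain ⟨P, hP, ⟨l, hl, rfl⟩, ⟨m, hm, rfl⟩, hne⟩ := h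
  have hlm : ¬ l.1.Parallel m.1 := fun e => hne <| Set.ext fun s =>
    and_congr_right fun _ => ⟨fun h => h.trans e, fun h => h.trans e.symm⟩
  have meet : ∀ {l m : AffLine F V}, ¬ l.1.Parallel m.1 → ∀ s ∈ {t : AffLine F V | t.1 ≤ P ∧
      t.1.Parallel l.1}, ∀ t ∈ {t : AffLine F V | t.1 ≤ P ∧ t.1.Parallel m.1},
      ∃! p, p ∈ s.1 ∧ p ∈ t.1 := by
    rintro l m hlm s ⟨hsP, hs⟩ t ⟨htP, ht⟩
    have hst : ¬ s.1.Parallel t.1 := fun e => hlm (hs.symm.trans (e.trans ht))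
    obtain ⟨p, hps, hpt⟩ := AffLine.exists_mem_of_le_plane hP hsP htP hst
    exact AffLine.existsUnique_of_ne (fun e => hst (e ▸ .refl _)) hps hpt
  have disj : ∀ l : AffLine F V, ∀ s ∈ {t : AffLine F V | t.1 ≤ P ∧ t.1.Parallel l.1},
      ∀ t ∈ {t : AffLine F V | t.1 ≤ P ∧ t.1.Parallel l.1}, ∀ p, p ∈ s.1 → p ∈ t.1 → s = t :=
    fun l s hs t ht p hps hpt => AffLine.eq_of_parallel (hs.2.trans ht.2.symm) hps hpt
  have cov : ∀ {l m : AffLine F V}, l.1 ≤ P → m.1 ≤ P → ∀ p ∈ l.1,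
      ∃ t ∈ {t : AffLine F V | t.1 ≤ P ∧ t.1.Parallel m.1}, p ∈ t.1 := by
    intro l m hl hm p hp
    refine ⟨.through p m.1.direction m.2.2, ⟨?_, ?_⟩, AffLine.mem_through _ _ _⟩
    · intro z hz
      have hz' : z ∈ AffineSubspace.mk' p m.1.direction := hz
      rw [AffineSubspace.mem_mk'] at hz'
      have := AffineSubspace.vadd_mem_of_mem_direction (AffineSubspace.direction_le hm hz') (hl hp)
      rwa [vsub_vadd] at this
    · rw [AffLine.parallel_iff, AffLine.direction_through]
  have hml : ¬ m.1.Parallel l.1 := fun e => hlm e.symm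
  -- Each class has `q` lines because it partitions the `q` points of a line of the other class.
  exact ⟨(ncard_eq_iff_cover (disj l) (meet hml m ⟨hm, .refl _⟩)).2 (cov hm hl),
    (ncard_eq_iff_cover (disj m) (meet hlm l ⟨hl, .refl _⟩)).2 (cov hl hm),
    disj l, disj m, meet hlm⟩

/-! ### Affine reguli -/

omit [Finite F] [Finite V] in
theorem pairwise_skew_disjoint {R : Set (AffLine F V)} (h : R.Pairwise Skew) :
    ∀ l ∈ R, ∀ m ∈ R, ∀ p, p ∈ l.1 → p ∈ m.1 → l = m :=
  fun _ hl _ hm p hpl hpm => by_contra fun hne => (h hl hm hne).1 ⟨p, hpl, hpm⟩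

namespace IsAffineRegulus

variable {A : AffineSubspace F V} {R : Set (AffLine F V)}

omit [Finite F] in
-- The lines of `R` partition the points of any one transversal.
theorem ncard_eq (h : IsAffineRegulus A R) : R.ncard = Nat.card F := by
  obtain ⟨l, hl⟩ := h.nonempty
  obtain ⟨p, hp⟩ := l.2.1
  obtain ⟨t, ht, -⟩ := h.exists_transversal l hl p hp
  exact (ncard_eq_iff_cover (pairwise_skew_disjoint h.skew) ht.2).2 (h.exists_line t ht)

omit [Finite F] in
theorem isGrid_of_subset {S : Set (AffLine F V)} (hR : IsAffineRegulus A R)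
    (hS : IsAffineRegulus A S) (h : S ⊆ transversals A R) : IsGrid R S :=
  ⟨hR.ncard_eq, hS.ncard_eq, pairwise_skew_disjoint hR.skew, pairwise_skew_disjoint hS.skew,
    fun l hl t ht => by simpa only [and_comm] using (h ht).2 l hl⟩

omit [Finite F] in
/-- Over a field with more than two elements, any two distinct transversals of an affine regulus
are skew. -/
theorem pairwise_skew_transversals (h : IsAffineRegulus A R) (hF : 3 ≤ Nat.card F) :
    (transversals A R).Pairwise Skew := by
  intro s hs t ht hne
  by_contra hsk
  -- At most one line `r` of `R` passes through the common point of `s` and `t`, if there is one.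
  -- Dropping it leaves `q - 1` lines, at least two since `q ≥ 3`.
  have hlines : ∃ l ∈ R, ∃ m ∈ R, l ≠ m ∧ (∀ p, p ∈ s.1 → p ∈ t.1 → p ∉ l.1 ∧ p ∉ m.1) := by
    obtain ⟨r, hr, hdisj⟩ : ∃ r ∈ R,
        ∀ l ∈ R, l ≠ r → ∀ p, p ∈ s.1 → p ∈ t.1 → p ∉ l.1 := by
      by_cases hm : ∃ p, p ∈ s.1 ∧ p ∈ t.1
      · obtain ⟨p, hps, hpt⟩ := hm
        obtain ⟨r, hr, hpr⟩ := h.exists_line s hs p hps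
        refine ⟨r, hr, fun l hl hlr x hxs hxt hxl => hlr ?_⟩
        have hxp : x = p := by_contra fun e => hne (AffLine.eq_of_mem e hxs hps hxt hpt)
        exact pairwise_skew_disjoint h.skew l hl r hr p (hxp ▸ hxl) hpr
      · obtain ⟨r, hr⟩ := h.nonempty
        exact ⟨r, hr, fun _ _ _ x hxs hxt => (hm ⟨x, hxs, hxt⟩).elim⟩
    have hcard : 1 < (R \ {r}).ncard := by
      have := Set.ncard_sdiff_singleton_add_one hr
      have := h.ncard_eq
      omega
    obtain ⟨l, m, hl, hm, hlm⟩ := (Set.one_lt_ncard_iff (Set.toFinite _)).1 hcard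
    exact ⟨l, hl.1, m, hm.1, hlm,
      fun p hps hpt => ⟨hdisj l hl.1 hl.2 p hps hpt, hdisj m hm.1 hm.2 p hps hpt⟩⟩
  obtain ⟨l, hl, m, hm, hlm, hlines⟩ := hlines
  have hP : IsFlat 2 (s.1 ⊔ t.1) := by
    by_cases hp : s.1.Parallel t.1
    · exact AffLine.isFlat_sup_of_parallel hp hne
    · by_cases hm : ∃ p, p ∈ s.1 ∧ p ∈ t.1
      · obtain ⟨p, hps, hpt⟩ := hm
        exact AffLine.isFlat_sup_of_mem hp hps hpt
      · exact (hsk ⟨hm, hp⟩).elim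
  -- Such lines meet `s` and `t` in different points and so lie in their plane, where two skew lines
  -- cannot fit.
  have hle : ∀ l ∈ R, (∀ p, p ∈ s.1 → p ∈ t.1 → p ∉ l.1) → l.1 ≤ s.1 ⊔ t.1 := by
    intro l hl hd
    obtain ⟨x, hxs, hxl⟩ := (hs.2 l hl).exists
    obtain ⟨y, hyt, hyl⟩ := (ht.2 l hl).exists
    have hxy : x ≠ y := by
      rintro rfl
      exact hd x hxs hyt hxl
    exact AffLine.le_of_mem hxy hxl hyl
      ((le_sup_left : s.1 ≤ s.1 ⊔ t.1) hxs) ((le_sup_right : t.1 ≤ s.1 ⊔ t.1) hyt)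
  have hskew := h.skew hl hm hlm
  exact hskew.1 (AffLine.exists_mem_of_le_plane hP
    (hle l hl fun p h1 h2 => (hlines p h1 h2).1) (hle m hm fun p h1 h2 => (hlines p h1 h2).2)
    hskew.2)

omit [Finite F] in
theorem isGrid_transversals (h : IsAffineRegulus A R) (hF : 3 ≤ Nat.card F) :
    IsGrid R (transversals A R) := by
  have hd := pairwise_skew_disjoint (h.pairwise_skew_transversals hF)
  have hmeet : ∀ l ∈ R, ∀ t ∈ transversals A R, ∃! p, p ∈ l.1 ∧ p ∈ t.1 :=
    fun l hl t ht => by simpa only [and_comm] using ht.2 l hl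
  obtain ⟨l, hl⟩ := h.nonempty
  exact ⟨h.ncard_eq, (ncard_eq_iff_cover hd (hmeet l hl)).2 (h.exists_transversal l hl),
    pairwise_skew_disjoint h.skew, hd, hmeet⟩

theorem isAffineRegulus_transversals (h : IsAffineRegulus A R) (hF : 3 ≤ Nat.card F) :
    IsAffineRegulus A (transversals A R) :=
  ((h.isGrid_transversals hF).symm.isAffineRegulus (h.pairwise_skew_transversals hF) h.flat
    (fun _ ht => ht.1) h.subset).1

/-- The ambient subspace is spanned by any two lines of the regulus. This makes the parametrization
by pairs `(A, R)` injective. -/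
theorem eq_of_eq {B : AffineSubspace F V} (h : IsAffineRegulus A R) (h' : IsAffineRegulus B R) :
    A = B := by
  have hcard : 1 < R.ncard := by
    rw [h.ncard_eq]
    exact Finite.one_lt_card
  obtain ⟨l, m, hl, hm, hne⟩ := (Set.one_lt_ncard_iff (Set.toFinite R)).1 hcard
  exact (AffLine.eq_sup_of_skew (h.skew hl hm hne) h.flat (h.subset l hl) (h.subset m hm)).trans
    (AffLine.eq_sup_of_skew (h.skew hl hm hne) h'.flat (h'.subset l hl) (h'.subset m hm)).symm

end IsAffineRegulus

omit [Finite F] in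
theorem AreOppositeReguli.isGrid {R S : Set (AffLine F V)} (h : AreOppositeReguli R S) :
    IsGrid R S := by
  obtain ⟨A, hR, hS, hRS⟩ := h
  exact hR.isGrid_of_subset hS hRS

end Grids

/-! ### The eigenspace as the kernel of the incidence matrix -/

section Eigenfunctions

variable {F V : Type*} [Field F] [AddCommGroup V] [Module F V] [Finite V]

open Classical in
/-- The sum of the values of `f` on the lines through `p`. -/
noncomputable def pointSum (f : AffLine F V → ℝ) (p : V) : ℝ :=
  ∑ l : AffLine F V, if p ∈ l.1 then f l else 0

theorem pointSum_neg (f : AffLine F V → ℝ) (p : V) : pointSum (-f) p = -pointSum f p := by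
  simp only [pointSum, Pi.neg_apply, ← Finset.sum_neg_distrib]
  exact Finset.sum_congr rfl fun l _ => by split_ifs <;> simp

omit [Finite V] in
open Classical in
-- The entrywise form of `Nᵀ N = q I + A`.
theorem card_inter [Fintype V] (l m : AffLine F V) :
    (Finset.univ.filter fun p : V => p ∈ l.1 ∧ p ∈ m.1).card =
      (if m = l then Nat.card F else 0) + if (blockGraph F V).Adj l m then 1 else 0 := by
  by_cases h : m = l
  · subst h
    have := m.ncard_eq
    rw [Set.ncard_eq_toFinset_card'] at this
    simp only [and_self, if_true, SimpleGraph.irrefl, if_false, add_zero, ← this]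
    congr 1
    ext
    simp
  · rw [if_neg h, zero_add]
    split_ifs with ha
    · obtain ⟨p, hl, hm⟩ := ha.2
      rw [Finset.card_eq_one]
      refine ⟨p, Finset.ext fun x => ?_⟩
      simp only [Finset.mem_filter, Finset.mem_univ, true_and, Finset.mem_singleton]
      exact ⟨fun hx => (AffLine.existsUnique_of_ne ha.1 hl hm).unique hx ⟨hl, hm⟩,
        fun e => e ▸ ⟨hl, hm⟩⟩
    · rw [Finset.card_eq_zero, Finset.filter_eq_empty_iff]
      exact fun p _ hp => ha ⟨fun e => h e.symm, p, hp⟩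

open Classical in
theorem sum_pointSum [Fintype V] (f : AffLine F V → ℝ) (l : AffLine F V) :
    ∑ p : V with p ∈ l.1, pointSum f p =
      Nat.card F * f l + ∑ m ∈ (blockGraph F V).neighborFinset l, f m := by
  have h : ∀ m : AffLine F V, (∑ p : V with p ∈ l.1, if p ∈ m.1 then f m else 0) =
      (if m = l then Nat.card F * f m else 0) +
        if (blockGraph F V).Adj l m then f m else 0 := by
    intro m
    rw [← Finset.sum_filter, Finset.filter_filter, Finset.sum_const, card_inter, nsmul_eq_mul]
    push_cast
    rw [add_mul, ite_mul, ite_mul, zero_mul, one_mul]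
  simp only [pointSum]
  rw [Finset.sum_comm, Finset.sum_congr rfl fun m _ => h m, Finset.sum_add_distrib,
    Finset.sum_ite_eq', if_pos (Finset.mem_univ l), ← Finset.sum_filter]
  congr 2
  ext m
  simp

open Classical in
/-- The eigenfunctions for the eigenvalue `-|F|` are the non-zero functions whose sum over the
lines through each point vanishes. -/
theorem isEigenfunction_iff (f : AffLine F V → ℝ) :
    IsEigenfunction (blockGraph F V) (-(Nat.card F : ℝ)) f ↔ f ≠ 0 ∧ ∀ p, pointSum f p = 0 := by
  have := Fintype.ofFinite V
  refine and_congr_right fun _ => ⟨fun h => ?_, fun h l => ?_⟩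
  · have h0 : ∀ l : AffLine F V, ∑ p : V with p ∈ l.1, pointSum f p = 0 := fun l => by
      rw [sum_pointSum]
      have := h l
      rw [neg_mul] at this
      rw [eq_comm, ← sub_eq_iff_eq_add', zero_sub, this]
    -- `⟨N f, N f⟩ = ⟨f, Nᵀ N f⟩`, and `h0` says that `Nᵀ N f = 0`.
    have hsq : ∑ p : V, pointSum f p * pointSum f p = 0 := by
      calc ∑ p : V, pointSum f p * pointSum f p
          = ∑ p : V, ∑ l : AffLine F V, f l * if p ∈ l.1 then pointSum f p else 0 := by
            refine Finset.sum_congr rfl fun p _ => ?_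
            conv_lhs => enter [1]; rw [pointSum]
            rw [Finset.sum_mul]
            exact Finset.sum_congr rfl fun l _ => by split_ifs <;> simp
        _ = ∑ l : AffLine F V, f l * ∑ p : V with p ∈ l.1, pointSum f p := by
            rw [Finset.sum_comm]
            refine Finset.sum_congr rfl fun l _ => ?_
            rw [← Finset.mul_sum, ← Finset.sum_filter]
        _ = 0 := Finset.sum_eq_zero fun l _ => by rw [h0, mul_zero]
    intro p
    exact mul_self_eq_zero.1
      ((Finset.sum_eq_zero_iff_of_nonneg fun p _ => mul_self_nonneg _).1 hsq p (Finset.mem_univ p))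
  · have h1 := sum_pointSum f l
    rw [Finset.sum_eq_zero fun p _ => h p] at h1
    rw [neg_mul, neg_eq_iff_add_eq_zero]
    rw [h1]

/-! ### The lower bound on the support and the case of equality -/

section Support

variable {f : AffLine F V → ℝ}

theorem exists_neg_of_pos (h : ∀ p, pointSum f p = 0) {l : AffLine F V} (hl : 0 < f l) {p : V}
    (hp : p ∈ l.1) : ∃ m : AffLine F V, f m < 0 ∧ p ∈ m.1 := by
  classical
  by_contra! hn
  have : 0 < pointSum f p := by
    refine Finset.sum_pos' (fun m _ => ?_) ⟨l, Finset.mem_univ l, by rwa [if_pos hp]⟩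
    split_ifs with hm
    · by_contra! hneg
      exact hn m hneg hm
    · exact le_rfl
  exact this.ne' (h p)

theorem exists_pos_of_neg (h : ∀ p, pointSum f p = 0) {l : AffLine F V} (hl : f l < 0) {p : V}
    (hp : p ∈ l.1) : ∃ m : AffLine F V, 0 < f m ∧ p ∈ m.1 := by
  simpa using exists_neg_of_pos (f := -f) (fun p => by rw [pointSum_neg, h, neg_zero])
    (by simpa using hl) hp

/-- A line of positive value has at least `|F|` lines of negative value meeting it, one through
each of its points; if there are no other lines of negative value, these are pairwise disjoint. -/
theorem card_le_ncard_neg (h : ∀ p, pointSum f p = 0) {l : AffLine F V} (hl : 0 < f l) :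
    Nat.card F ≤ {m | f m < 0}.ncard ∧ ({m | f m < 0}.ncard = Nat.card F →
      ∀ m, f m < 0 → (∃ p, p ∈ l.1 ∧ p ∈ m.1) ∧
        ∀ m', f m' < 0 → ∀ p ∈ l.1, p ∈ m.1 → p ∈ m'.1 → m = m') := by
  have hex : ∀ p : V, ∃ m : AffLine F V, p ∈ l.1 → f m < 0 ∧ p ∈ m.1 := fun p => by
    by_cases hp : p ∈ l.1
    · obtain ⟨m, hm⟩ := exists_neg_of_pos h hl hp
      exact ⟨m, fun _ => hm⟩
    · exact ⟨l, fun e => absurd e hp⟩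
  choose g hg using hex
  -- A negative line sharing two points with `l` would be `l`, which is positive.
  have huniq : ∀ m, f m < 0 → ∀ p ∈ l.1, ∀ x ∈ l.1, p ∈ m.1 → x ∈ m.1 → p = x := by
    intro m hm p hp x hx hpm hxm
    by_contra hne
    have := AffLine.eq_of_mem hne hp hx hpm hxm
    exact absurd (this ▸ hl) hm.not_gt
  have hmaps : Set.MapsTo g (l.1 : Set V) {m | f m < 0} := fun p hp => (hg p hp).1
  have hinj : Set.InjOn g (l.1 : Set V) := fun p hp x hx e =>
    huniq (g p) (hg p hp).1 p hp x hx (hg p hp).2 (e ▸ (hg x hx).2)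
  rw [← l.ncard_eq]
  refine ⟨Set.ncard_le_ncard_of_injOn g hmaps hinj (Set.toFinite _), fun hcard => ?_⟩
  -- In the case of equality the injection `g` is onto, so every negative line meets `l`, and the
  -- one through a point `p` of `l` is `g p`.
  have himg : g '' (l.1 : Set V) = {m | f m < 0} :=
    Set.eq_of_subset_of_ncard_le hmaps.image_subset (by rw [hcard, hinj.ncard_image])
      (Set.toFinite _)
  have hsurj : ∀ m, f m < 0 → ∀ p ∈ l.1, p ∈ m.1 → g p = m := by
    intro m hm p hp hpm
    have : m ∈ g '' (l.1 : Set V) := himg ▸ hm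
    obtain ⟨x, hx, rfl⟩ := this
    rw [huniq _ hm p hp x hx hpm (hg x hx).2]
  intro m hm
  constructor
  · have : m ∈ g '' (l.1 : Set V) := himg ▸ hm
    obtain ⟨x, hx, rfl⟩ := this
    exact ⟨x, hx, (hg x hx).2⟩
  · intro m' hm' p hp hpm hpm'
    rw [← hsurj m hm p hp hpm, hsurj m' hm' p hp hpm']

theorem card_le_ncard_pos (h : ∀ p, pointSum f p = 0) {l : AffLine F V} (hl : f l < 0) :
    Nat.card F ≤ {m | 0 < f m}.ncard ∧ ({m | 0 < f m}.ncard = Nat.card F →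
      ∀ m, 0 < f m → (∃ p, p ∈ l.1 ∧ p ∈ m.1) ∧
        ∀ m', 0 < f m' → ∀ p ∈ l.1, p ∈ m.1 → p ∈ m'.1 → m = m') := by
  simpa using card_le_ncard_neg (f := -f) (fun p => by rw [pointSum_neg, h, neg_zero])
    (by simpa using hl)

theorem supportCard_eq (f : AffLine F V → ℝ) :
    supportCard f = {m | 0 < f m}.ncard + {m | f m < 0}.ncard := by
  rw [supportCard, ← Set.ncard_union_eq _ (Set.toFinite _) (Set.toFinite _)]
  · congr 1
    ext m
    simp only [Function.mem_support, Set.mem_union, Set.mem_ofPred_eq]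
    rw [ne_iff_lt_or_gt, or_comm]
  · exact Set.disjoint_left.2 fun m (h1 : 0 < f m) (h2 : f m < 0) => lt_asymm h1 h2

theorem exists_pos_and_neg (h : ∀ p, pointSum f p = 0) (h0 : f ≠ 0) :
    (∃ l, 0 < f l) ∧ ∃ l, f l < 0 := by
  obtain ⟨l, hl⟩ := Function.ne_iff.1 h0
  obtain ⟨p, hp⟩ := l.2.1
  rcases lt_or_gt_of_ne hl with hl | hl
  · obtain ⟨m, hm, -⟩ := exists_pos_of_neg h hl hp
    exact ⟨⟨m, hm⟩, l, hl⟩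
  · obtain ⟨m, hm, -⟩ := exists_neg_of_pos h hl hp
    exact ⟨⟨l, hl⟩, m, hm⟩

theorem two_mul_card_le_supportCard
    (h : IsEigenfunction (blockGraph F V) (-(Nat.card F : ℝ)) f) :
    2 * Nat.card F ≤ supportCard f := by
  obtain ⟨h0, h⟩ := (isEigenfunction_iff f).1 h
  obtain ⟨⟨l, hl⟩, m, hm⟩ := exists_pos_and_neg h h0
  have h1 := (card_le_ncard_neg h hl).1
  have h2 := (card_le_ncard_pos h hm).1
  rw [supportCard_eq]
  omega

/-- The structure of the eigenfunctions that attain the bound. -/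
theorem isGrid_of_supportCard_eq [Finite F]
    (h : IsEigenfunction (blockGraph F V) (-(Nat.card F : ℝ)) f)
    (hf : supportCard f = 2 * Nat.card F) :
    IsGrid {m | 0 < f m} {m | f m < 0} ∧
      ∃ c : ℝ, 0 < c ∧ (∀ l, 0 < f l → f l = c) ∧ ∀ l, f l < 0 → f l = -c := by
  classical
  obtain ⟨h0, h⟩ := (isEigenfunction_iff f).1 h
  obtain ⟨⟨l, hl⟩, m, hm⟩ := exists_pos_and_neg h h0
  have h1 := (card_le_ncard_neg h hl).1
  have h2 := (card_le_ncard_pos h hm).1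
  rw [supportCard_eq] at hf
  have hneg : {m | f m < 0}.ncard = Nat.card F := by omega
  have hpos : {m | 0 < f m}.ncard = Nat.card F := by omega
  have hmeet : ∀ l, 0 < f l → ∀ m, f m < 0 → ∃! p, p ∈ l.1 ∧ p ∈ m.1 := by
    intro l hl m hm
    obtain ⟨p, hpl, hpm⟩ := ((card_le_ncard_neg h hl).2 hneg m hm).1
    exact AffLine.existsUnique_of_ne (fun e => lt_asymm hm (e ▸ hl)) hpl hpm
  have hgrid : IsGrid {m | 0 < f m} {m | f m < 0} := by
    refine ⟨hpos, hneg, fun s hs t ht p hps hpt => ?_, fun s hs t ht p hps hpt => ?_, hmeet⟩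
    -- A common point of two positive lines lies on a negative line, and that line meets the
    -- positive ones in distinct points.
    · obtain ⟨m, hm, hpm⟩ := exists_neg_of_pos h hs hps
      exact ((card_le_ncard_pos h hm).2 hpos s hs).2 t ht p hpm hps hpt
    · obtain ⟨l, hl, hpl⟩ := exists_pos_of_neg h hs hps
      exact ((card_le_ncard_neg h hl).2 hneg s hs).2 t ht p hpl hps hpt
  have hval : ∀ l, 0 < f l → ∀ m, f m < 0 → f l = -f m := by
    intro l hl m hm
    obtain ⟨p, hpl, hpm⟩ := (hmeet l hl m hm).exists
    -- By disjointness within each sign, `l` and `m` are the only support lines through `p`.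
    have hs : pointSum f p = f l + f m := by
      rw [pointSum, Finset.sum_eq_add l m (fun e => lt_asymm hm (e ▸ hl)) _ (by simp) (by simp),
        if_pos hpl, if_pos hpm]
      rintro s - ⟨hsl, hsm⟩
      split_ifs with hps
      · by_contra hne
        rcases lt_or_gt_of_ne hne with hs | hs
        · exact hsm (hgrid.disjoint_right s hs m hm p hps hpm)
        · exact hsl (hgrid.disjoint_left s hs l hl p hps hpl)
      · rfl
    rw [h p] at hs
    linarith
  refine ⟨hgrid, f l, hl, fun s hs => ?_, fun s hs => ?_⟩
  · rw [hval s hs m hm, hval l hl m hm]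
  · rw [hval l hl s hs, neg_neg]

end Support

/-! ### The signed indicators -/

section SignedIndicator

variable {W : Type*} {C D : Set W}

theorem signedIndicator_of_mem_left (h : Disjoint C D) {w : W} (hw : w ∈ C) :
    signedIndicator (C, D) w = 1 := by
  simp [signedIndicator, hw, Set.disjoint_left.1 h hw]

theorem signedIndicator_of_mem_right (h : Disjoint C D) {w : W} (hw : w ∈ D) :
    signedIndicator (C, D) w = -1 := by
  simp [signedIndicator, hw, Set.disjoint_right.1 h hw]

theorem signedIndicator_of_notMem {w : W} (hC : w ∉ C) (hD : w ∉ D) :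
    signedIndicator (C, D) w = 0 := by
  simp [signedIndicator, hC, hD]

theorem signedIndicator_eq_one_iff (h : Disjoint C D) {w : W} :
    signedIndicator (C, D) w = 1 ↔ w ∈ C := by
  refine ⟨fun e => ?_, signedIndicator_of_mem_left h⟩
  by_contra hC
  by_cases hD : w ∈ D
  · rw [signedIndicator_of_mem_right h hD] at e
    norm_num at e
  · rw [signedIndicator_of_notMem hC hD] at e
    norm_num at e

theorem signedIndicator_eq_neg_one_iff (h : Disjoint C D) {w : W} :
    signedIndicator (C, D) w = -1 ↔ w ∈ D := by
  refine ⟨fun e => ?_, signedIndicator_of_mem_right h⟩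
  by_contra hD
  by_cases hC : w ∈ C
  · rw [signedIndicator_of_mem_left h hC] at e
    norm_num at e
  · rw [signedIndicator_of_notMem hC hD] at e
    norm_num at e

theorem isSignValued_signedIndicator (h : Disjoint C D) :
    IsSignValued (signedIndicator (C, D)) := by
  intro w
  by_cases hC : w ∈ C
  · exact Or.inl (signedIndicator_of_mem_left h hC)
  · by_cases hD : w ∈ D
    · exact Or.inr (Or.inl (signedIndicator_of_mem_right h hD))
    · exact Or.inr (Or.inr (signedIndicator_of_notMem hC hD))

theorem IsSignValued.eq_one {f : W → ℝ} (h : IsSignValued f) {w : W} (hw : 0 < f w) :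
    f w = 1 := by
  rcases h w with e | e | e
  · exact e
  · linarith
  · linarith

theorem IsSignValued.eq_neg_one {f : W → ℝ} (h : IsSignValued f) {w : W} (hw : f w < 0) :
    f w = -1 := by
  rcases h w with e | e | e
  · linarith
  · exact e
  · linarith

theorem IsSignValued.eq_signedIndicator {f : W → ℝ} (h : IsSignValued f) :
    signedIndicator ({w | 0 < f w}, {w | f w < 0}) = f := by
  have hd : Disjoint {w | 0 < f w} {w | f w < 0} :=
    Set.disjoint_left.2 fun w (h1 : 0 < f w) (h2 : f w < 0) => lt_asymm h1 h2
  funext w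
  rcases lt_trichotomy (f w) 0 with hw | hw | hw
  · rw [signedIndicator_of_mem_right hd hw, h.eq_neg_one hw]
  · rw [signedIndicator_of_notMem (fun e => e.ne' hw) (fun e => e.ne hw), hw]
  · rw [signedIndicator_of_mem_left hd hw, h.eq_one hw]

theorem signedIndicator_pos_iff (h : Disjoint C D) {w : W} :
    0 < signedIndicator (C, D) w ↔ w ∈ C :=
  ⟨fun hw => (signedIndicator_eq_one_iff h).1 ((isSignValued_signedIndicator h).eq_one hw),
    fun hw => by rw [signedIndicator_of_mem_left h hw]; exact one_pos⟩

theorem signedIndicator_neg_iff (h : Disjoint C D) {w : W} :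
    signedIndicator (C, D) w < 0 ↔ w ∈ D :=
  ⟨fun hw => (signedIndicator_eq_neg_one_iff h).1 ((isSignValued_signedIndicator h).eq_neg_one hw),
    fun hw => by rw [signedIndicator_of_mem_right h hw]; norm_num⟩

theorem signedIndicator_injOn :
    Set.InjOn signedIndicator {T : Set W × Set W | Disjoint T.1 T.2} := by
  rintro ⟨C, D⟩ h ⟨C', D'⟩ h' e
  refine Prod.ext (Set.ext fun w => ?_) (Set.ext fun w => ?_)
  · rw [← signedIndicator_eq_one_iff h, e]
    exact signedIndicator_eq_one_iff h'
  · rw [← signedIndicator_eq_neg_one_iff h, e]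
    exact signedIndicator_eq_neg_one_iff h'

theorem signedIndicator_mul_pos_iff (h : Disjoint C D) {v w : W} :
    0 < signedIndicator (C, D) v * signedIndicator (C, D) w ↔
      (v ∈ C ∧ w ∈ C) ∨ (v ∈ D ∧ w ∈ D) := by
  rw [mul_pos_iff, signedIndicator_pos_iff h, signedIndicator_pos_iff h,
    signedIndicator_neg_iff h, signedIndicator_neg_iff h]

end SignedIndicator

/-! ### Grids yield optimal eigenfunctions -/

namespace IsGrid

variable [Finite F] {C D : Set (AffLine F V)}

/-- A point lies on exactly one line of each side or on no line of the grid, so every point sum is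
`1 - 1` or `0`. -/
theorem isEigenfunction (h : IsGrid C D) :
    IsEigenfunction (blockGraph F V) (-(Nat.card F : ℝ)) (signedIndicator (C, D)) := by
  classical
  rw [isEigenfunction_iff]
  constructor
  · obtain ⟨l, hl, -⟩ := h.exists_pair
    exact fun e => one_ne_zero ((signedIndicator_of_mem_left h.disjoint hl).symm.trans
      (congrFun e l))
  · intro p
    by_cases hp : ∃ l ∈ C, p ∈ l.1
    · obtain ⟨l, hl, hpl⟩ := hp
      obtain ⟨m, hm, hpm⟩ := h.cover hl hpl
      rw [pointSum, Finset.sum_eq_add l m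
        (fun e => Set.disjoint_left.1 h.disjoint hl (e ▸ hm)) _ (by simp) (by simp),
        if_pos hpl, if_pos hpm, signedIndicator_of_mem_left h.disjoint hl,
        signedIndicator_of_mem_right h.disjoint hm, add_neg_cancel]
      rintro s - ⟨hsl, hsm⟩
      split_ifs with hps
      · exact signedIndicator_of_notMem (fun hs => hsl (h.disjoint_left s hs l hl p hps hpl))
          (fun hs => hsm (h.disjoint_right s hs m hm p hps hpm))
      · rfl
    · refine Finset.sum_eq_zero fun s _ => ?_
      split_ifs with hps
      · refine signedIndicator_of_notMem (fun hs => hp ⟨s, hs, hps⟩) (fun hs => hp ?_)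
        exact h.symm.cover hs hps
      · rfl

theorem supportCard_eq (h : IsGrid C D) :
    supportCard (signedIndicator (C, D)) = 2 * Nat.card F := by
  rw [_root_.supportCard_eq]
  simp only [signedIndicator_pos_iff h.disjoint, signedIndicator_neg_iff h.disjoint,
    Set.ofPred_mem_eq, h.ncard_left, h.ncard_right]
  omega

theorem isOptimalEigenfunction (h : IsGrid C D) :
    IsOptimalEigenfunction (blockGraph F V) (-(Nat.card F : ℝ)) (signedIndicator (C, D)) :=
  ⟨h.isEigenfunction, fun _ hg => h.supportCard_eq ▸ two_mul_card_le_supportCard hg⟩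

theorem isFirstType_iff (h : IsGrid C D) :
    IsFirstType (signedIndicator (C, D)) ↔
      (∀ l ∈ C, ∀ m ∈ C, l.1.Parallel m.1) ∧ ∀ l ∈ D, ∀ m ∈ D, l.1.Parallel m.1 := by
  simp only [IsFirstType, signedIndicator_mul_pos_iff h.disjoint]
  exact ⟨fun H => ⟨fun l hl m hm => H l m (Or.inl ⟨hl, hm⟩), fun l hl m hm =>
    H l m (Or.inr ⟨hl, hm⟩)⟩, fun H l m hlm => hlm.elim (fun e => H.1 l e.1 m e.2)
    fun e => H.2 l e.1 m e.2⟩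

theorem isSecondType_iff (h : IsGrid C D) :
    IsSecondType (signedIndicator (C, D)) ↔ C.Pairwise Skew ∧ D.Pairwise Skew := by
  simp only [IsSecondType, signedIndicator_mul_pos_iff h.disjoint]
  exact ⟨fun H => ⟨fun l hl m hm hne => H l m hne (Or.inl ⟨hl, hm⟩), fun l hl m hm hne =>
    H l m hne (Or.inr ⟨hl, hm⟩)⟩, fun H l m hne hlm => hlm.elim (fun e => H.1 e.1 e.2 hne)
    fun e => H.2 e.1 e.2 hne⟩

theorem xor_types (h : IsGrid C D) :
    Xor (IsFirstType (signedIndicator (C, D))) (IsSecondType (signedIndicator (C, D))) := by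
  rw [h.isFirstType_iff, h.isSecondType_iff]
  obtain ⟨l, hl, m, hm, hne⟩ := h.exists_pair
  rcases h.pairwise_skew_or_parallel with H | H
  · exact Or.inr ⟨H, fun H' => (H.1 hl hm hne).2 (H'.1 l hl m hm)⟩
  · exact Or.inl ⟨H, fun H' => (H'.1 hl hm hne).2 (H.1 l hl m hm)⟩

end IsGrid

end Eigenfunctions

/-! ### Existence of both types -/

section Paraboloid

variable {F V : Type*} [Field F] [AddCommGroup V] [Module F V]

/-- The line `L c` is the section `x = c` of `z = x * y`. Exchanging `e₁` and `e₂` gives the other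
ruling. -/
theorem exists_ruling {e₁ e₂ e₃ : V}
    (h : ∀ a b c : F, a • e₁ + b • e₂ + c • e₃ = 0 → a = 0 ∧ b = 0 ∧ c = 0) :
    ∃ L : F → AffLine F V, ∀ c, (L c).1.direction = Submodule.span F {e₂ + c • e₃} ∧
      ∀ p, p ∈ (L c).1 ↔ ∃ y : F, p = c • e₁ + y • (e₂ + c • e₃) := by
  have hne : ∀ c : F, e₂ + c • e₃ ≠ 0 := fun c hc =>
    one_ne_zero (h 0 1 c (by rw [← hc]; module)).2.1
  refine ⟨fun c => .through (c • e₁) _ (finrank_span_singleton (hne c)), fun c =>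
    ⟨AffLine.direction_through _ _ _, fun p => ?_⟩⟩
  change p ∈ AffineSubspace.mk' _ _ ↔ _
  rw [AffineSubspace.mem_mk', Submodule.mem_span_singleton]
  refine exists_congr fun y => ?_
  rw [vsub_eq_sub, eq_sub_iff_add_eq', eq_comm]

/-- The two rulings of the hyperbolic paraboloid `z = x * y`. -/
theorem exists_isGrid_pairwise_skew [Finite F] [Finite V] (hV : 3 ≤ Module.finrank F V) :
    ∃ C D : Set (AffLine F V), IsGrid C D ∧ C.Pairwise Skew ∧ D.Pairwise Skew := by
  obtain ⟨e, he⟩ : ∃ e : Fin 3 → V, LinearIndependent F e :=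
    ⟨_, (Module.finBasis F V).linearIndependent.comp _ (Fin.castLE_injective hV)⟩
  have h : ∀ a b c : F, a • e 0 + b • e 1 + c • e 2 = 0 → a = 0 ∧ b = 0 ∧ c = 0 := by
    intro a b c habc
    have := Fintype.linearIndependent_iff.1 he ![a, b, c]
      (by simpa [Fin.sum_univ_three] using habc)
    exact ⟨this 0, this 1, this 2⟩
  have h' : ∀ a b c : F, a • e 1 + b • e 0 + c • e 2 = 0 → a = 0 ∧ b = 0 ∧ c = 0 := by
    intro a b c habc
    obtain ⟨h1, h2, h3⟩ := h b a c (by rw [← habc]; module)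
    exact ⟨h2, h1, h3⟩
  generalize e 0 = e₁, e 1 = e₂, e 2 = e₃ at h h'
  have skew : ∀ {e₁ e₂ e₃ : V},
      (∀ a b c : F, a • e₁ + b • e₂ + c • e₃ = 0 → a = 0 ∧ b = 0 ∧ c = 0) →
      ∀ {L : F → AffLine F V}, (∀ c, (L c).1.direction = Submodule.span F {e₂ + c • e₃} ∧
        ∀ p, p ∈ (L c).1 ↔ ∃ y : F, p = c • e₁ + y • (e₂ + c • e₃)) →
      ∀ c d, c ≠ d → Skew (L c) (L d) := by
    intro e₁ e₂ e₃ h L hL c d hcd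
    constructor
    · rintro ⟨p, hc, hd⟩
      obtain ⟨y, hy⟩ := ((hL c).2 p).1 hc
      obtain ⟨z, hz⟩ := ((hL d).2 p).1 hd
      refine hcd (sub_eq_zero.1 (h (c - d) (y - z) (y * c - z * d) ?_).1)
      rw [← sub_eq_zero.2 (hy.symm.trans hz)]
      module
    · intro hp
      rw [AffLine.parallel_iff, (hL c).1, (hL d).1] at hp
      have hm := hp ▸ Submodule.mem_span_singleton_self (R := F) (e₂ + c • e₃)
      obtain ⟨t, ht⟩ := Submodule.mem_span_singleton.1 hm
      obtain ⟨-, h1, h2⟩ := h 0 (t - 1) (t * d - c) (by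
        rw [← sub_eq_zero.2 ht]
        module)
      rw [sub_eq_zero.1 h1, one_mul] at h2
      exact hcd (sub_eq_zero.1 h2).symm
  obtain ⟨L, hL⟩ := exists_ruling h
  obtain ⟨M, hM⟩ := exists_ruling h'
  have card : ∀ {L : F → AffLine F V}, (∀ c d, c ≠ d → Skew (L c) (L d)) →
      (Set.range L).ncard = Nat.card F ∧ (Set.range L).Pairwise Skew := by
    intro L hs
    constructor
    · rw [← Set.image_univ, Set.InjOn.ncard_image, Set.ncard_univ]
      intro c _ d _ e
      by_contra hne
      exact (hs c d hne).2 (e ▸ .refl _)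
    · rintro _ ⟨c, rfl⟩ _ ⟨d, rfl⟩ hne
      exact hs c d fun e => hne (e ▸ rfl)
  obtain ⟨hC, hCs⟩ := card (skew h hL)
  obtain ⟨hD, hDs⟩ := card (skew h' hM)
  refine ⟨Set.range L, Set.range M, ⟨hC, hD, pairwise_skew_disjoint hCs,
    pairwise_skew_disjoint hDs, ?_⟩, hCs, hDs⟩
  rintro _ ⟨c, rfl⟩ _ ⟨d, rfl⟩
  -- The common point is `(c, d, c * d)`.
  refine AffLine.existsUnique_of_ne (p := c • e₁ + d • (e₂ + c • e₃)) ?_ ?_ ?_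
  · intro e
    have hm := Submodule.mem_span_singleton_self (R := F) (e₂ + c • e₃)
    rw [← (hL c).1, e, (hM d).1] at hm
    obtain ⟨t, ht⟩ := Submodule.mem_span_singleton.1 hm
    have := (h t (-1) (t * d - c) (by rw [← sub_eq_zero.2 ht]; module)).2.1
    exact one_ne_zero (neg_eq_zero.1 this)
  · exact ((hL c).2 _).2 ⟨d, rfl⟩
  · exact ((hM d).2 _).2 ⟨c, by module⟩

/-- Two crossing lines of the paraboloid supply a plane and two directions in it. -/
theorem exists_isParallelClassPair [Finite F] [Finite V] (hV : 3 ≤ Module.finrank F V) :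
    ∃ C D : Set (AffLine F V), IsParallelClassPair C D := by
  obtain ⟨C, D, h, -⟩ := exists_isGrid_pairwise_skew hV
  obtain ⟨l, hl, -⟩ := h.exists_pair
  obtain ⟨m, hm, -⟩ := h.symm.exists_pair
  obtain ⟨p, hpl, hpm⟩ := (h.meet l hl m hm).exists
  have hn := h.not_parallel hl hm
  refine ⟨_, _, l.1 ⊔ m.1, AffLine.isFlat_sup_of_mem hn hpl hpm, ⟨l, le_sup_left, rfl⟩,
    ⟨m, le_sup_right, rfl⟩, fun e => hn ?_⟩
  have : l ∈ {t : AffLine F V | t.1 ≤ l.1 ⊔ m.1 ∧ t.1.Parallel m.1} :=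
    e ▸ ⟨le_sup_left, .refl _⟩
  exact this.2

end Paraboloid

/-! ### Strong regularity and primitivity -/

section StronglyRegular

variable {F V : Type*} [Field F] [AddCommGroup V] [Module F V]

/-- The number of lines through a point. -/
noncomputable def replicationNumber (F V : Type*) [Field F] [AddCommGroup V] [Module F V] : ℕ :=
  {l : AffLine F V | (0 : V) ∈ l.1}.ncard

theorem ncard_lines_through (p : V) :
    {l : AffLine F V | p ∈ l.1}.ncard = replicationNumber F V := by
  have key : ∀ p r : V, ∀ l : AffLine F V, p ∈ l.1 →
      AffLine.through p (AffLine.through r l.1.direction l.2.2).1.direction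
        (AffLine.through r l.1.direction l.2.2).2.2 = l := fun p r l hl =>
    AffLine.eq_of_parallel (AffLine.parallel_iff.2 (by simp only [AffLine.direction_through]))
      (AffLine.mem_through _ _ _) hl
  refine Set.ncard_congr (fun l _ => .through 0 l.1.direction l.2.2)
    (fun l _ => AffLine.mem_through 0 l.1.direction l.2.2) (fun l m hl hm e => ?_) fun l hl => ?_
  · rw [← key p 0 l hl, ← key p 0 m hm]
    simp only [e]
  · exact ⟨.through p l.1.direction l.2.2, AffLine.mem_through p l.1.direction l.2.2, key 0 p l hl⟩

variable [Finite V]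

open Classical in
theorem card_lines_through_sdiff (p : V) (T : Finset (AffLine F V)) (hT : ∀ l ∈ T, p ∈ l.1) :
    (Finset.univ.filter fun s : AffLine F V => s ∉ T ∧ p ∈ s.1).card =
      replicationNumber F V - T.card := by
  have h : (Finset.univ.filter fun s : AffLine F V => s ∉ T ∧ p ∈ s.1) =
      (Finset.univ.filter fun s : AffLine F V => p ∈ s.1) \ T := by
    ext s
    simp [and_comm]
  rw [h, Finset.card_sdiff_of_subset fun l hl => by simpa using hT l hl, ← ncard_lines_through p,
    Set.ncard_eq_toFinset_card']
  congr 2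
  ext
  simp

theorem blockGraph_isRegularOfDegree :
    (blockGraph F V).IsRegularOfDegree (Nat.card F * (replicationNumber F V - 1)) := by
  classical
  have := Fintype.ofFinite V
  intro l
  -- A line other than `l` shares at most one point with it, so adjacency equals the number of
  -- common points; `l` itself is excluded, having `q`.
  have h : ∀ s, (if (blockGraph F V).Adj l s then 1 else 0) =
      ∑ p : V with p ∈ l.1, if s ∉ ({l} : Finset (AffLine F V)) ∧ p ∈ s.1 then 1 else 0 := by
    intro s
    by_cases hs : s = l
    · simp [hs]
    · rw [← Finset.card_filter, Finset.filter_filter]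
      simpa [hs] using (card_inter l s).symm
  rw [← SimpleGraph.card_neighborFinset_eq_degree, SimpleGraph.neighborFinset_eq_filter,
    Finset.card_filter, Finset.sum_congr rfl fun s _ => h s, Finset.sum_comm]
  have hp : ∀ p ∈ Finset.univ.filter (fun p : V => p ∈ l.1),
      (∑ s : AffLine F V, if s ∉ ({l} : Finset (AffLine F V)) ∧ p ∈ s.1 then 1 else 0) =
        replicationNumber F V - 1 := by
    intro p hp
    rw [← Finset.card_filter]
    convert card_lines_through_sdiff p {l} (by simpa using hp) using 2
    simp
  rw [Finset.sum_congr rfl hp, Finset.sum_const, smul_eq_mul]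
  have := card_inter l l
  simp only [and_self, if_true, SimpleGraph.irrefl, if_false, add_zero] at this
  rw [this]

open Classical in
-- A common neighbour determines its points `x` on `l` and `y` on `m`, so it is counted once; any
-- other line outside `{l, m}` misses `l` or `m`.
theorem card_commonNeighbors [Fintype V] (l m : AffLine F V) :
    ((blockGraph F V).commonNeighbors l m).ncard =
      ∑ x : V with x ∈ l.1, ∑ y : V with y ∈ m.1, (Finset.univ.filter fun s : AffLine F V =>
        s ∉ ({l, m} : Finset (AffLine F V)) ∧ x ∈ s.1 ∧ y ∈ s.1).card := by
  have h : ∀ s, (if s ∈ (blockGraph F V).commonNeighbors l m then 1 else 0) =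
      ∑ x : V with x ∈ l.1, ∑ y : V with y ∈ m.1,
        if s ∉ ({l, m} : Finset (AffLine F V)) ∧ x ∈ s.1 ∧ y ∈ s.1 then 1 else 0 := by
    intro s
    by_cases hs : s = l ∨ s = m
    · have : s ∉ (blockGraph F V).commonNeighbors l m := by
        rintro ⟨h1, h2⟩
        rcases hs with rfl | rfl
        · exact h1.1 rfl
        · exact h2.1 rfl
      simp [hs, this]
    · have hl := card_inter l s
      have hm := card_inter m s
      rw [not_or] at hs
      rw [if_neg hs.1, zero_add] at hl
      rw [if_neg hs.2, zero_add] at hm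
      have hmem : s ∈ (blockGraph F V).commonNeighbors l m ↔
        (blockGraph F V).Adj l s ∧ (blockGraph F V).Adj m s := Iff.rfl
      have : ∀ x y : V, (if s ∉ ({l, m} : Finset (AffLine F V)) ∧ x ∈ s.1 ∧ y ∈ s.1 then 1 else 0)
          = (if x ∈ s.1 then 1 else 0) * (if y ∈ s.1 then 1 else 0) := by
        intro x y
        by_cases hx : x ∈ s.1 <;> simp [hs, hx]
      simp only [this, ← Finset.mul_sum, ← Finset.sum_mul]
      rw [← Finset.card_filter, ← Finset.card_filter, Finset.filter_filter, Finset.filter_filter,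
        hl, hm, if_congr hmem rfl rfl]
      by_cases ha : (blockGraph F V).Adj l s <;> simp [ha]
  rw [Set.ncard_eq_toFinset_card', ← Set.filter_mem_univ_eq_toFinset, Finset.card_filter,
    Finset.sum_congr rfl fun s _ => h s, Finset.sum_comm]
  refine Finset.sum_congr rfl fun x _ => ?_
  rw [Finset.sum_comm]
  refine Finset.sum_congr rfl fun y _ => ?_
  rw [← Finset.card_filter]

open Classical in
theorem card_join {l m : AffLine F V} {x y : V} (hxy : x ≠ y)
    (hl : ¬ (x ∈ l.1 ∧ y ∈ l.1)) (hm : ¬ (x ∈ m.1 ∧ y ∈ m.1)) :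
    (Finset.univ.filter fun s : AffLine F V =>
      s ∉ ({l, m} : Finset (AffLine F V)) ∧ x ∈ s.1 ∧ y ∈ s.1).card = 1 := by
  obtain ⟨t, hx, hy⟩ := AffLine.exists_mem_mem (F := F) hxy
  rw [Finset.card_eq_one]
  refine ⟨t, Finset.ext fun s => ?_⟩
  simp only [Finset.mem_filter, Finset.mem_univ, true_and, Finset.mem_singleton,
    Finset.mem_insert, not_or]
  constructor
  · rintro ⟨-, hxs, hys⟩
    exact AffLine.eq_of_mem hxy hxs hys hx hy
  · rintro rfl
    exact ⟨⟨fun e => hl (e ▸ ⟨hx, hy⟩), fun e => hm (e ▸ ⟨hx, hy⟩)⟩, hx, hy⟩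

omit [Finite V] in
open Classical in
theorem card_points [Fintype V] (l : AffLine F V) :
    (Finset.univ.filter fun p : V => p ∈ l.1).card = Nat.card F := by
  simpa using card_inter l l

/-- With `p` the common point, the pair `(p, p)` contributes the other lines through `p`. Pairs with
exactly one entry `p` are joined only by `l` or `m`, and each of the remaining `(q - 1)²` pairs
contributes its joining line. -/
theorem ncard_commonNeighbors_of_adj {l m : AffLine F V} (h : (blockGraph F V).Adj l m) :
    ((blockGraph F V).commonNeighbors l m).ncard =
      replicationNumber F V - 2 + (Nat.card F - 1) * (Nat.card F - 1) := by
  classical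
  have := Fintype.ofFinite V
  obtain ⟨hne, p, hpl, hpm⟩ := h
  have hmeet : ∀ x, x ∈ l.1 → x ∈ m.1 → x = p := fun x h1 h2 =>
    (AffLine.existsUnique_of_ne hne hpl hpm).unique ⟨h1, h2⟩ ⟨hpl, hpm⟩
  rw [card_commonNeighbors,
    ← Finset.add_sum_erase _ _ (show p ∈ Finset.univ.filter fun x : V => x ∈ l.1 by simpa)]
  congr 1
  · rw [Finset.sum_eq_single p]
    · have := card_lines_through_sdiff p {l, m} (by
        intro s hs
        rcases Finset.mem_insert.1 hs with rfl | hs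
        · exact hpl
        · exact Finset.mem_singleton.1 hs ▸ hpm)
      rw [Finset.card_pair hne] at this
      simpa only [and_self] using this
    · intro y hy hyp
      rw [Finset.card_eq_zero, Finset.filter_eq_empty_iff]
      rintro s - ⟨hs, hps, hys⟩
      refine hs (Finset.mem_insert_of_mem (Finset.mem_singleton.2 ?_))
      exact AffLine.eq_of_mem hyp hys hps (Finset.mem_filter.1 hy).2 hpm
    · intro hp
      exact absurd (by simpa using hpm) hp
  · rw [← card_points l, ← Finset.card_erase_of_mem
      (show p ∈ Finset.univ.filter fun x : V => x ∈ l.1 by simpa), ← smul_eq_mul,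
      ← Finset.sum_const]
    refine Finset.sum_congr rfl fun x hx => ?_
    obtain ⟨hxp, hxl⟩ := Finset.mem_erase.1 hx
    replace hxl : x ∈ l.1 := (Finset.mem_filter.1 hxl).2
    have hp : p ∈ Finset.univ.filter fun x : V => x ∈ m.1 := by simpa
    rw [← Finset.add_sum_erase _ _ hp, Finset.card_erase_of_mem (by simpa), card_points l,
      ← card_points m, ← Finset.card_erase_of_mem hp, Finset.card_eq_zero.2, zero_add]
    · rw [Finset.card_eq_sum_ones]
      refine Finset.sum_congr rfl fun y hy => ?_
      obtain ⟨hyp, hym⟩ := Finset.mem_erase.1 hy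
      replace hym : y ∈ m.1 := (Finset.mem_filter.1 hym).2
      exact card_join (fun e => hxp (hmeet x hxl (e ▸ hym))) (fun h => hyp (hmeet y h.2 hym))
        fun h => hxp (hmeet x hxl h.1)
    · rw [Finset.filter_eq_empty_iff]
      rintro s - ⟨hs, hxs, hps⟩
      exact hs (Finset.mem_insert.2 (Or.inl (AffLine.eq_of_mem hxp hxs hps hxl hpl)))

theorem ncard_commonNeighbors_of_not_adj {l m : AffLine F V} (hne : l ≠ m)
    (h : ¬ (blockGraph F V).Adj l m) :
    ((blockGraph F V).commonNeighbors l m).ncard = Nat.card F * Nat.card F := by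
  classical
  have := Fintype.ofFinite V
  have hd : ∀ p, p ∈ l.1 → p ∉ m.1 := fun p h1 h2 => h ⟨hne, p, h1, h2⟩
  rw [card_commonNeighbors]
  have key : ∀ x ∈ Finset.univ.filter (fun x : V => x ∈ l.1),
      ∀ y ∈ Finset.univ.filter (fun y : V => y ∈ m.1), (Finset.univ.filter fun s : AffLine F V =>
        s ∉ ({l, m} : Finset (AffLine F V)) ∧ x ∈ s.1 ∧ y ∈ s.1).card = 1 := by
    intro x hx y hy
    rw [Finset.mem_filter] at hx hy
    exact card_join (fun e => hd x hx.2 (e ▸ hy.2)) (fun h => hd y h.2 hy.2)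
      fun h => hd x hx.2 h.1
  rw [Finset.sum_congr rfl fun x hx => Finset.sum_congr rfl (key x hx)]
  simp [card_points]

theorem blockGraph_isSRGWith :
    (blockGraph F V).IsSRGWith (Fintype.card (AffLine F V))
      (Nat.card F * (replicationNumber F V - 1))
      (replicationNumber F V - 2 + (Nat.card F - 1) * (Nat.card F - 1))
      (Nat.card F * Nat.card F) where
  card := rfl
  regular := blockGraph_isRegularOfDegree
  of_adj l m h := by
    rw [← ncard_commonNeighbors_of_adj h, ← Nat.card_eq_fintype_card, Nat.card_coe_set_eq]
  of_not_adj l m hne h := by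
    rw [← ncard_commonNeighbors_of_not_adj hne h, ← Nat.card_eq_fintype_card,
      Nat.card_coe_set_eq]

omit [Finite V] in
theorem blockGraph_connected [Nonempty (AffLine F V)] : (blockGraph F V).Connected := by
  refine ⟨fun l m => ?_⟩
  by_cases hlm : l = m
  · exact hlm ▸ .refl _
  by_cases h : (blockGraph F V).Adj l m
  · exact h.reachable
  obtain ⟨x, hx⟩ := l.2.1
  obtain ⟨y, hy⟩ := m.2.1
  have hym : y ∉ l.1 := fun e => h ⟨hlm, y, e, hy⟩
  have hxm : x ∉ m.1 := fun e => h ⟨hlm, x, hx, e⟩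
  obtain ⟨t, hxt, hyt⟩ := AffLine.exists_mem_mem (F := F) (x := x) (y := y)
    fun e => hxm (e ▸ hy)
  have h1 : (blockGraph F V).Adj l t := ⟨fun e => hym (e ▸ hyt), x, hx, hxt⟩
  have h2 : (blockGraph F V).Adj t m := ⟨fun e => hxm (e ▸ hxt), y, hyt, hy⟩
  exact h1.reachable.trans h2.reachable

/-- Two meeting lines span a plane, which is not the whole space. The parallel to `l` through a
point outside misses that plane, so it is a common neighbour in the complement. -/
theorem blockGraph_compl_connected [Nonempty (AffLine F V)] (hV : 3 ≤ Module.finrank F V) :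
    (blockGraph F V)ᶜ.Connected := by
  refine ⟨fun l m => ?_⟩
  by_cases hlm : l = m
  · exact hlm ▸ .refl _
  by_cases h : (blockGraph F V).Adj l m
  swap
  · exact SimpleGraph.Adj.reachable ((SimpleGraph.compl_adj _ _ _).2 ⟨hlm, h⟩)
  obtain ⟨-, p, hpl, hpm⟩ := h
  have hP : IsFlat 2 (l.1 ⊔ m.1) :=
    AffLine.isFlat_sup_of_mem (fun e => hlm (AffLine.eq_of_parallel e hpl hpm)) hpl hpm
  obtain ⟨x, hx⟩ : ∃ x, x ∉ l.1 ⊔ m.1 := by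
    by_contra! hall
    have htop : l.1 ⊔ m.1 = ⊤ := eq_top_iff.2 fun x _ => hall x
    have := hP.2
    rw [htop, AffineSubspace.direction_top, finrank_top] at this
    omega
  have hdir : ∀ y, y ∈ (AffLine.through x l.1.direction l.2.2).1 → y ∉ l.1 ⊔ m.1 := by
    intro y hy hyP
    have hxy := AffineSubspace.vsub_mem_direction (AffLine.mem_through x l.1.direction l.2.2) hy
    rw [AffLine.direction_through] at hxy
    refine hx ?_
    rw [← sub_add_cancel x y]
    exact AffineSubspace.vadd_mem_of_mem_direction
      (AffineSubspace.direction_le le_sup_left hxy) hyP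
  set t := AffLine.through x l.1.direction l.2.2
  have hxt : x ∈ t.1 := AffLine.mem_through _ _ _
  have key : ∀ s : AffLine F V, s.1 ≤ l.1 ⊔ m.1 → (blockGraph F V)ᶜ.Adj s t := fun s hs =>
    (SimpleGraph.compl_adj _ _ _).2 ⟨fun e => hx (hs (e ▸ hxt)), fun ⟨_, y, hys, hyt⟩ =>
      hdir y hyt (hs hys)⟩
  exact (key l le_sup_left).reachable.trans (key m le_sup_right).symm.reachable

end StronglyRegular

/-! ### The value of the bound and the main theorem -/

theorem weightDistributionBound_blockGraph {q r : ℕ} (hq : 1 ≤ q) (hr : 2 ≤ r) :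
    weightDistributionBound (q * (r - 1)) (r - 2 + (q - 1) * (q - 1)) (q * q) (-(q : ℝ)) =
      2 * q := by
  -- Shifting `q` and `r` removes the truncated subtractions. In the original variables the quotient
  -- is `q - 1`, as `r` cancels, and the bound is `1 + q + (q - 1)`.
  obtain ⟨q, rfl⟩ := Nat.exists_eq_add_of_le' hq
  obtain ⟨r, rfl⟩ := Nat.exists_eq_add_of_le' hr
  have h : (0 : ℝ) < (q : ℝ) + 1 := by positivity
  have hq : ((-((q : ℝ) + 1) - (r + q * q)) * (-((q : ℝ) + 1)) - (q + 1) * (r + 1)) /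
      ((q + 1) * (q + 1)) = q := by
    field_simp
    ring
  simp only [weightDistributionBound, Nat.add_sub_cancel, show r + 2 - 1 = r + 1 by omega]
  push_cast
  rw [hq, abs_neg, abs_of_pos h, abs_of_nonneg (Nat.cast_nonneg q)]
  ring

theorem theorem2 {F V : Type*} [Field F] [Fintype F] [AddCommGroup V] [Module F V] [Finite V]
    (n q : ℕ) (hn : 3 ≤ n) (hV : Module.finrank F V = n) (hq : Fintype.card F = q) :
    -- the weight-distribution bound for the eigenvalue `-q` equals `2q` and is tight
    (∃ k l μ : ℕ,
      (blockGraph F V).IsSRGWith (Fintype.card (AffLine F V)) k l μ ∧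
      (blockGraph F V).Connected ∧ (blockGraph F V)ᶜ.Connected ∧
      -(q : ℝ) ≠ k ∧
      weightDistributionBound k l μ (-(q : ℝ)) = 2 * q ∧
      (∀ f, IsEigenfunction (blockGraph F V) (-(q : ℝ)) f →
        weightDistributionBound k l μ (-(q : ℝ)) ≤ supportCard f) ∧
      (∃ f, IsEigenfunction (blockGraph F V) (-(q : ℝ)) f ∧
        (supportCard f : ℝ) = weightDistributionBound k l μ (-(q : ℝ)))) ∧
    -- up to a constant factor, optimal eigenfunctions have values in `{1, -1, 0}`
    (∀ f, IsOptimalEigenfunction (blockGraph F V) (-(q : ℝ)) f →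
      ∃ c : ℝ, c ≠ 0 ∧ IsSignValued (c • f)) ∧
    -- every optimal eigenfunction is of exactly one of the two types
    (∀ f, IsOptimalEigenfunction (blockGraph F V) (-(q : ℝ)) f →
      Xor (IsFirstType f) (IsSecondType f)) ∧
    -- both types occur
    (∃ f, IsOptimalEigenfunction (blockGraph F V) (-(q : ℝ)) f ∧ IsFirstType f) ∧
    (∃ f, IsOptimalEigenfunction (blockGraph F V) (-(q : ℝ)) f ∧ IsSecondType f) ∧
    -- the first type
    Set.BijOn signedIndicator
      {T : Set (AffLine F V) × Set (AffLine F V) | IsParallelClassPair T.1 T.2}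
      {f | IsOptimalEigenfunction (blockGraph F V) (-(q : ℝ)) f ∧ IsSignValued f ∧
        IsFirstType f} ∧
    -- the second type
    Set.BijOn signedIndicator
      {T : Set (AffLine F V) × Set (AffLine F V) | AreOppositeReguli T.1 T.2}
      {f | IsOptimalEigenfunction (blockGraph F V) (-(q : ℝ)) f ∧ IsSignValued f ∧
        IsSecondType f} ∧
    -- for `q ≥ 3` an affine regulus determines its opposite
    (3 ≤ q →
      (∀ (A : AffineSubspace F V) (R : Set (AffLine F V)), IsAffineRegulus A R →
        IsAffineRegulus A (transversals A R)) ∧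
      Set.BijOn
        (fun x : AffineSubspace F V × Set (AffLine F V) =>
          signedIndicator (x.2, transversals x.1 x.2))
        {x | IsAffineRegulus x.1 x.2}
        {f | IsOptimalEigenfunction (blockGraph F V) (-(q : ℝ)) f ∧ IsSignValued f ∧
          IsSecondType f}) := by
  have : Finite F := inferInstance
  have hqF : q = Nat.card F := by rw [← hq, Nat.card_eq_fintype_card]
  subst hqF
  clear hq
  have h3 : 3 ≤ Module.finrank F V := hV ▸ hn
  obtain ⟨C₀, D₀, h₀, hC₀, hD₀⟩ := exists_isGrid_pairwise_skew h3
  obtain ⟨C₁, D₁, h₁⟩ := exists_isParallelClassPair h3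
  -- the optimal eigenfunctions are the multiples of the signed indicators of grids
  have hopt : ∀ f, IsOptimalEigenfunction (blockGraph F V) (-(Nat.card F : ℝ)) f →
      IsGrid {m | 0 < f m} {m | f m < 0} ∧
        ∃ c : ℝ, 0 < c ∧ (∀ l, 0 < f l → f l = c) ∧ ∀ l, f l < 0 → f l = -c := by
    intro f hf
    -- Comparison with the paraboloid's eigenfunction shows that the optimum is `2 * q`.
    refine isGrid_of_supportCard_eq hf.1 (le_antisymm ?_ (two_mul_card_le_supportCard hf.1))
    exact h₀.supportCard_eq ▸ hf.2 _ h₀.isEigenfunction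
  have hxor : ∀ f, IsOptimalEigenfunction (blockGraph F V) (-(Nat.card F : ℝ)) f →
      Xor (IsFirstType f) (IsSecondType f) := by
    intro f hf
    have hg := (hopt f hf).1
    -- The types depend only on signs, so `f` may be replaced by the signed indicator of its sign
    -- sets.
    have hs : ∀ l m, 0 < signedIndicator ({m | 0 < f m}, {m | f m < 0}) l *
        signedIndicator ({m | 0 < f m}, {m | f m < 0}) m ↔ 0 < f l * f m := fun l m => by
      rw [signedIndicator_mul_pos_iff hg.disjoint, mul_pos_iff]
      rfl
    simpa only [IsFirstType, IsSecondType, hs] using hg.xor_types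
  have hsecond : Set.BijOn signedIndicator
      {T : Set (AffLine F V) × Set (AffLine F V) | AreOppositeReguli T.1 T.2}
      {f | IsOptimalEigenfunction (blockGraph F V) (-(Nat.card F : ℝ)) f ∧ IsSignValued f ∧
        IsSecondType f} := by
    refine ⟨fun T hT => ?_, fun T hT T' hT' e => ?_, fun f hf => ?_⟩
    · have hg := AreOppositeReguli.isGrid hT
      obtain ⟨A, hR, hS, -⟩ := hT
      exact ⟨hg.isOptimalEigenfunction, isSignValued_signedIndicator hg.disjoint,
        hg.isSecondType_iff.2 ⟨hR.skew, hS.skew⟩⟩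
    · exact signedIndicator_injOn (AreOppositeReguli.isGrid hT).disjoint
        (AreOppositeReguli.isGrid hT').disjoint e
    · obtain ⟨hf, hsign, hty⟩ := hf
      have hg := (hopt f hf).1
      rw [← hsign.eq_signedIndicator, hg.isSecondType_iff] at hty
      exact ⟨_, hg.areOppositeReguli hty.1 hty.2, hsign.eq_signedIndicator⟩
  refine ⟨?_, ?_, hxor, ?_, ?_, ?_, hsecond, ?_⟩
  · obtain ⟨l, hl, -⟩ := h₀.exists_pair
    obtain ⟨m, hm, -⟩ := h₀.symm.exists_pair
    obtain ⟨p, hpl, hpm⟩ := (h₀.meet l hl m hm).exists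
    have hr : 2 ≤ replicationNumber F V := by
      rw [← ncard_lines_through p]
      exact (Set.one_lt_ncard_iff (Set.toFinite _)).2
        ⟨l, m, hpl, hpm, fun e => h₀.not_parallel hl hm (e ▸ .refl _)⟩
    have hq1 : 1 < Nat.card F := Finite.one_lt_card
    have hbound := weightDistributionBound_blockGraph hq1.le hr
    have : Nonempty (AffLine F V) := ⟨l⟩
    refine ⟨_, _, _, blockGraph_isSRGWith, blockGraph_connected, blockGraph_compl_connected h3,
      ?_, hbound, fun f hf => ?_, _, h₀.isEigenfunction, ?_⟩
    · have h1 : (0 : ℝ) < Nat.card F := by exact_mod_cast hq1.le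
      have h2 : (0 : ℝ) ≤ (Nat.card F * (replicationNumber F V - 1) : ℕ) := Nat.cast_nonneg _
      linarith
    · rw [hbound]
      exact_mod_cast two_mul_card_le_supportCard hf
    · rw [hbound, h₀.supportCard_eq]
      push_cast
      rfl
  · intro f hf
    obtain ⟨-, c, hc, hpos, hneg⟩ := hopt f hf
    refine ⟨c⁻¹, inv_ne_zero hc.ne', fun w => ?_⟩
    rw [Pi.smul_apply, smul_eq_mul]
    rcases lt_trichotomy (f w) 0 with hw | hw | hw
    · rw [hneg w hw, mul_neg, inv_mul_cancel₀ hc.ne']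
      exact Or.inr (Or.inl rfl)
    · rw [hw, mul_zero]
      exact Or.inr (Or.inr rfl)
    · rw [hpos w hw, inv_mul_cancel₀ hc.ne']
      exact Or.inl rfl
  · obtain ⟨P, -, hC, hD, -⟩ := id h₁
    exact ⟨_, h₁.isGrid.isOptimalEigenfunction,
      h₁.isGrid.isFirstType_iff.2 ⟨fun _ hl _ hm => hC.parallel hl hm,
        fun _ hl _ hm => hD.parallel hl hm⟩⟩
  · exact ⟨_, h₀.isOptimalEigenfunction, h₀.isSecondType_iff.2 ⟨hC₀, hD₀⟩⟩
  · refine ⟨fun T hT => ?_, fun T hT T' hT' e => ?_, fun f hf => ?_⟩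
    · have hg := IsParallelClassPair.isGrid hT
      obtain ⟨P, -, hC, hD, -⟩ := hT
      exact ⟨hg.isOptimalEigenfunction, isSignValued_signedIndicator hg.disjoint,
        hg.isFirstType_iff.2 ⟨fun _ hl _ hm => hC.parallel hl hm,
          fun _ hl _ hm => hD.parallel hl hm⟩⟩
    · exact signedIndicator_injOn (IsParallelClassPair.isGrid hT).disjoint
        (IsParallelClassPair.isGrid hT').disjoint e
    · obtain ⟨hf, hsign, hty⟩ := hf
      have hg := (hopt f hf).1
      rw [← hsign.eq_signedIndicator, hg.isFirstType_iff] at hty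
      exact ⟨_, hg.isParallelClassPair hty.1, hsign.eq_signedIndicator⟩
  · intro hq
    have hopp : ∀ (A : AffineSubspace F V) (R : Set (AffLine F V)), IsAffineRegulus A R →
        AreOppositeReguli R (transversals A R) := fun A R hR =>
      ⟨A, hR, hR.isAffineRegulus_transversals hq, subset_rfl⟩
    refine ⟨fun A R hR => hR.isAffineRegulus_transversals hq, fun x hx => ?_,
      fun x hx y hy e => ?_, fun f hf => ?_⟩
    · exact hsecond.mapsTo (hopp x.1 x.2 hx)
    · have hR : x.2 = y.2 :=
        congrArg Prod.fst (hsecond.injOn (hopp x.1 x.2 hx) (hopp y.1 y.2 hy) e)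
      have hx' : IsAffineRegulus x.1 x.2 := hx
      have hy' : IsAffineRegulus y.1 y.2 := hy
      exact Prod.ext (hx'.eq_of_eq (hR ▸ hy')) hR
    · obtain ⟨⟨R, S⟩, ⟨A, hR, hS, hRS⟩, rfl⟩ := hsecond.surjOn hf
      -- Both sets have `q` lines, so the inclusion is an equality.
      have hST : S = transversals A R := Set.eq_of_subset_of_ncard_le hRS
        ((hR.isGrid_transversals hq).ncard_right.trans hS.ncard_eq.symm).le (Set.toFinite _)
      exact ⟨(A, R), hR, by rw [hST]⟩
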